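/- Let $n\ge 0$ be an integer and $c\in\mathbb R$, and let $Q_c^{n+1}$ be the simply connected space form of constant curvature $c$ (sphere, Euclidean space or hyperbolic space). Let $M$ be a connected complete Riemannian manifold of dimension $n$, isometrically immersed in $Q_c^{n+1}$ with a global smooth unit normal field $N$. Let $A(X)=-\widetilde\nabla_X N$ be the shape operator, let $S_r$ be the $r$-th elementary symmetric function of the eigenvalues of $A$ ($S_r=0$ for $r>n$), and let $P_1=S_1 I-A$. Let $dM$ be the Riemannian volume measure and $B_R$ the geodesic ball of $M$ of radius $R$ about a fixed point; the 1-volume of $M$ is $\int_M S_1\,dM$. An open set $U\subset M$ is called strongly stable if $$\int_M (S_1S_2-3S_3+c(n-1)S_1)f^2\,dM\le\int_M\langle P_1(\nabla f),\nabla f\rangle\,dM\qquad\text{for all } f\in C_c^\infty(U).$$ Suppose that $S_2$ is constant, $S_2\ge 0$, $S_2>-\frac{n(n-1)}{2}c$, and that $S_1$ vanishes nowhere, where the unit normal $N$ is chosen such that $S_1>0$. 1) If $M\setminus K$ is strongly stable for some compact $K\subset M$, then either the 1-volume of $M$ is finite, or $$\lim_{R\to+\infty}\frac1{R^2}\int_{B_R}S_1\,dM=+\infty$$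 for every choice of the center of the balls. 2) If $M$ is strongly stable, then $$\lim_{R\to+\infty}\frac1{R^2}\int_{B_R}S_1\,dM=+\infty$$ for every choice of the center of the balls. In particular, $M$ has infinite 1-volume. -/

import Mathlib

open MeasureTheory Filter Set Bundle Manifold
open scoped ContDiff Topology

noncomputable section

namespace SpaceFormHypersurface

/-- The vector space `ℝⁿ⁺¹ × ℝ`, in which the space forms `Q_c^{n+1}` are realised. -/
abbrev Ambient (n : ℕ) : Type := EuclideanSpace ℝ (Fin (n + 1)) × ℝ

/-- The Euclidean inner product of `ℝⁿ⁺¹` as a continuous bilinear form. -/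
def euclideanForm (n : ℕ) :
    EuclideanSpace ℝ (Fin (n + 1)) →L[ℝ] EuclideanSpace ℝ (Fin (n + 1)) →L[ℝ] ℝ :=
  innerSL ℝ

/-- The symmetric bilinear form `⟨x, y⟩ + sign(c) t s` on `ℝⁿ⁺¹ × ℝ`: the Euclidean inner product
of `ℝⁿ⁺²` if `c > 0`, the Lorentz product if `c < 0`; if `c = 0`, its restriction to `ℝⁿ⁺¹ × {0}`
is the Euclidean inner product of `ℝⁿ⁺¹`. -/
def ambientForm (n : ℕ) (c : ℝ) : Ambient n →L[ℝ] Ambient n →L[ℝ] ℝ :=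
  (euclideanForm n).bilinearComp (ContinuousLinearMap.fst ℝ (EuclideanSpace ℝ (Fin (n + 1))) ℝ)
      (ContinuousLinearMap.fst ℝ (EuclideanSpace ℝ (Fin (n + 1))) ℝ) +
    Real.sign c • (ContinuousLinearMap.mul ℝ ℝ).bilinearComp
      (ContinuousLinearMap.snd ℝ (EuclideanSpace ℝ (Fin (n + 1))) ℝ)
      (ContinuousLinearMap.snd ℝ (EuclideanSpace ℝ (Fin (n + 1))) ℝ)

theorem ambientForm_apply (n : ℕ) (c : ℝ) (u v : Ambient n) :
    ambientForm n c u v = inner ℝ u.1 v.1 + Real.sign c * (u.2 * v.2) := by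
  simp [ambientForm, euclideanForm]
  rfl

/-- The simply connected space form `Q_c^{n+1}` of constant curvature `c`: the sphere of radius
`1/√c` in `ℝⁿ⁺²` if `c > 0`, Euclidean space `ℝⁿ⁺¹ × {0}` if `c = 0`, and the upper sheet of the
hyperboloid `⟨v, v⟩ = 1/c` in Minkowski space if `c < 0`, with the metric induced by
`ambientForm n c`. -/
def spaceForm (n : ℕ) (c : ℝ) : Set (Ambient n) :=
  {v | (c = 0 → v.2 = 0) ∧ (c ≠ 0 → ambientForm n c v v = 1 / c) ∧ (c < 0 → 0 < v.2)}

/-- The tangent space of `Q_c^{n+1}` at the point `v`, as a set of vectors of `ℝⁿ⁺¹ × ℝ`. -/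
def spaceFormTangent (n : ℕ) (c : ℝ) (v : Ambient n) : Set (Ambient n) :=
  {w | (c = 0 → w.2 = 0) ∧ (c ≠ 0 → ambientForm n c v w = 0)}

section

variable {n : ℕ} {M : Type*} [MetricSpace M] [ChartedSpace (EuclideanSpace ℝ (Fin n)) M]

instance finiteDimensional_tangentSpace (p : M) :
    FiniteDimensional ℝ (TangentSpace (𝓡 n) p) :=
  inferInstanceAs (FiniteDimensional ℝ (EuclideanSpace ℝ (Fin n)))

/-- The differential at `p` of a map from `M` to the vector space `ℝⁿ⁺¹ × ℝ`. -/
def differential (F : M → Ambient n) (p : M) : TangentSpace (𝓡 n) p →L[ℝ] Ambient n :=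
  mfderiv (𝓡 n) 𝓘(ℝ, Ambient n) F p

variable [RiemannianBundle (fun p : M => TangentSpace (𝓡 n) p)]

instance completeSpace_tangentSpace (p : M) : CompleteSpace (TangentSpace (𝓡 n) p) :=
  FiniteDimensional.complete ℝ _

/-- The Riemannian gradient of a function on `M`: `⟨∇f, X⟩ = df(X)`. -/
def grad (f : M → ℝ) (p : M) : TangentSpace (𝓡 n) p :=
  (InnerProductSpace.toDual ℝ (TangentSpace (𝓡 n) p)).symm (mfderiv (𝓡 n) 𝓘(ℝ, ℝ) f p)

end

/-- An oriented immersed hypersurface of `Q_c^{n+1}`: a smooth isometric immersion of the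
Riemannian manifold `M` of dimension `n`, together with a smooth unit normal field. -/
structure OrientedHypersurface (n : ℕ) (c : ℝ) (M : Type*) [MetricSpace M]
    [ChartedSpace (EuclideanSpace ℝ (Fin n)) M]
    [RiemannianBundle (fun p : M => TangentSpace (𝓡 n) p)] where
  /-- the immersion -/
  immersion : M → Ambient n
  /-- the unit normal field `N` -/
  normal : M → Ambient n
  immersion_smooth : ContMDiff (𝓡 n) 𝓘(ℝ, Ambient n) ∞ immersion
  normal_smooth : ContMDiff (𝓡 n) 𝓘(ℝ, Ambient n) ∞ normal
  immersion_mem : ∀ p, immersion p ∈ spaceForm n c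
  isometric : ∀ (p : M) (X Y : TangentSpace (𝓡 n) p),
    ambientForm n c (differential immersion p X) (differential immersion p Y) = inner ℝ X Y
  normal_mem : ∀ p, normal p ∈ spaceFormTangent n c (immersion p)
  normal_unit : ∀ p, ambientForm n c (normal p) (normal p) = 1
  normal_orthogonal : ∀ (p : M) (X : TangentSpace (𝓡 n) p),
    ambientForm n c (normal p) (differential immersion p X) = 0

namespace OrientedHypersurface

variable {n : ℕ} {c : ℝ} {M : Type*} [MetricSpace M]
  [ChartedSpace (EuclideanSpace ℝ (Fin n)) M]
  [RiemannianBundle (fun p : M => TangentSpace (𝓡 n) p)]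

/-- The shape operator `A(X) = -∇̃_X N` on `T_pM`, i.e. the operator with
`⟨A X, Y⟩ = -⟨∇̃_X N, Y⟩` for all `Y ∈ T_pM`. The covariant derivative `∇̃_X N` of `Q_c^{n+1}` is
the component tangent to `Q_c^{n+1}` of the flat derivative `dN(X)`, so that
`⟨∇̃_X N, Y⟩ = ⟨dN(X), Y⟩`. -/
def shapeOperator (x : OrientedHypersurface n c M) (p : M) :
    TangentSpace (𝓡 n) p →ₗ[ℝ] TangentSpace (𝓡 n) p where
  toFun X := (InnerProductSpace.toDual ℝ (TangentSpace (𝓡 n) p)).symm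
    (-(ambientForm n c (differential x.normal p X)).comp (differential x.immersion p))
  map_add' X Y := by
    rw [← map_add]
    congr 1
    ext Z
    simp
    ring
  map_smul' a X := by
    have h : -(ambientForm n c (differential x.normal p (a • X))).comp
        (differential x.immersion p) =
        a • -(ambientForm n c (differential x.normal p X)).comp (differential x.immersion p) := by
      ext Z
      simp
    rw [h]
    simp

/-- `S_r(p)`: the `r`-th elementary symmetric function of the principal curvatures, that is, of the
eigenvalues of the shape operator at `p`, counted with multiplicity. It is `0` for `r > n`. -/
def S (x : OrientedHypersurface n c M) (r : ℕ) (p : M) : ℝ :=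
  (x.shapeOperator p).charpoly.roots.esymm r

/-- The first Newton transformation `P₁ = S₁ I - A`. -/
def P₁ (x : OrientedHypersurface n c M) (p : M) :
    TangentSpace (𝓡 n) p →ₗ[ℝ] TangentSpace (𝓡 n) p :=
  x.S 1 p • LinearMap.id - x.shapeOperator p

variable [MeasurableSpace M] [BorelSpace M]

/-- The Riemannian volume measure `dM` of `M`: the `n`-dimensional Hausdorff measure of the
Riemannian distance, normalised to be Lebesgue measure on Euclidean space `ℝⁿ`. -/
def vol (_x : OrientedHypersurface n c M) : Measure M := μHE[n]

/-- The part `U` (an open subset) of the hypersurface is strongly stable: for all smooth `f` with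
compact support in `U`,
`∫ (S₁ S₂ - 3 S₃ + c (n - 1) S₁) f² dM ≤ ∫ ⟨P₁ ∇f, ∇f⟩ dM`. -/
def StronglyStableOn (x : OrientedHypersurface n c M) (U : Set M) : Prop :=
  ∀ f : M → ℝ, ContMDiff (𝓡 n) 𝓘(ℝ, ℝ) ∞ f → HasCompactSupport f → tsupport f ⊆ U →
    ∫ p, (x.S 1 p * x.S 2 p - 3 * x.S 3 p + c * ((n : ℝ) - 1) * x.S 1 p) * f p ^ 2 ∂x.vol ≤
      ∫ p, inner ℝ (x.P₁ p (grad f p)) (grad f p) ∂x.vol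

/-- The 1-volume `∫_M S₁ dM ∈ [0, ∞]` (for a hypersurface with `S₁ ≥ 0`). -/
def oneVolume (x : OrientedHypersurface n c M) : ENNReal :=
  ∫⁻ p, ENNReal.ofReal (x.S 1 p) ∂x.vol

end OrientedHypersurface

end SpaceFormHypersurface

end

/-! Write λ_i for the principal curvatures. Since S₂ ≥ 0, ∑ λ_i² = S₁² - 2S₂ ≤ S₁², so |λ_i| ≤ S₁
and 0 ≤ ⟨P₁X, X⟩ ≤ 2S₁|X|². Moreover S₁S₂ - 3S₃ = ∑ λ_i²(S₁ - λ_i), and Okumura's inequality for the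
traceless part of A bounds this below by (2/n)S₁S₂ (`two_mul_S_one_mul_S_two_le`). The stability
potential is therefore at least δS₁ with δ = (2/n)S₂ + c(n-1), and δ > 0 is exactly the hypothesis
S₂ > -n(n-1)c/2. Stability thus becomes a weighted Poincaré-type inequality δ∫S₁f² ≤ 2∫S₁|∇f|².

Test it on a cutoff that vanishes near a ball containing K, equals 1 on a large annulus and decays
with slope O(1/ρ). With V(ρ) = ∫_{B_ρ} S₁ this gives δV(ρ/2 - 2) ≤ const + E·V(ρ)/ρ²
(`exists_growth_inequality`). If the 1-volume is infinite, the left side diverges, hence so does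
V(ρ)/ρ². If all of M is stable, no inner cutoff is needed and the constant disappears. Then V(ρ) ≥
const·ρ² with a positive constant, so V → ∞ and the previous argument applies.

The analysis behind the test needs compact balls (Hopf–Rinow, `properSpace_of_complete`), a smooth
substitute for the distance function (`exists_smooth_approx`), a Hausdorff measure that is finite on
compact sets and positive on open ones, and symmetry of A together with continuity of S_r
(`isSymmetric_shapeOperator`, `continuous_S`). -/

noncomputable section

set_option linter.unusedSectionVars false

namespace SpaceFormHypersurface

/-! ### Symmetric functions of the principal curvatures. -/

section SymmetricFunctions

/-- Newton's identities in degrees 1, 2, 3. The third combination is p₁p₂ - p₃ in power sums, the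
form in which the stability potential can be estimated. -/
theorem newton_identities_le_three {ι : Type*} [Fintype ι] (l : ι → ℝ) :
    (Finset.univ.val.map l).esymm 1 = ∑ i, l i ∧
    2 * (Finset.univ.val.map l).esymm 2 = (∑ i, l i) ^ 2 - ∑ i, l i ^ 2 ∧
    (Finset.univ.val.map l).esymm 1 * (Finset.univ.val.map l).esymm 2 -
      3 * (Finset.univ.val.map l).esymm 3 = ∑ i, l i ^ 2 * ((∑ j, l j) - l i) := by
  have key : ∀ k : ℕ, (k : ℝ) * (Finset.univ.val.map l).esymm k = (-1) ^ (k + 1) *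
      ∑ a ∈ Finset.HasAntidiagonal.antidiagonal k with a.1 < k,
        (-1) ^ a.1 * (Finset.univ.val.map l).esymm a.1 * ∑ i, l i ^ a.2 := by
    intro k
    have h := congrArg (MvPolynomial.aeval l) (MvPolynomial.mul_esymm_eq_sum ι ℝ k)
    simpa only [map_mul, map_natCast, map_sum, map_pow, map_neg, map_one,
      MvPolynomial.aeval_esymm_eq_multiset_esymm, MvPolynomial.psum, MvPolynomial.aeval_X] using h
  have h0 : (Finset.univ.val.map l).esymm 0 = 1 := by simp [Multiset.esymm]
  have h1 := key 1
  have h2 := key 2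
  have h3 := key 3
  rw [Finset.sum_filter] at h1 h2 h3
  simp only [Finset.Nat.antidiagonal_succ, Finset.Nat.antidiagonal_zero, Finset.map_singleton,
    Finset.sum_cons, Finset.sum_singleton, Finset.map_cons] at h1 h2 h3
  norm_num [h0] at h1 h2 h3
  have hp : ∑ i, l i ^ 2 * ((∑ j, l j) - l i) = (∑ j, l j) * (∑ i, l i ^ 2) - ∑ i, l i ^ 3 := by
    rw [Finset.mul_sum, ← Finset.sum_sub_distrib]
    exact Finset.sum_congr rfl fun i _ => by ring
  rw [hp]
  rw [h1] at h2 h3 ⊢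
  refine ⟨rfl, by linarith, ?_⟩
  linarith

theorem abs_le_sum_of_sum_sq_le {ι : Type*} [Fintype ι] (l : ι → ℝ) (h1 : 0 ≤ ∑ i, l i)
    (h2 : ∑ i, l i ^ 2 ≤ (∑ i, l i) ^ 2) (i : ι) : |l i| ≤ ∑ j, l j := by
  apply abs_le_of_sq_le_sq _ h1
  exact (Finset.single_le_sum (f := fun j => l j ^ 2) (fun j _ => sq_nonneg _)
    (Finset.mem_univ i)).trans h2

/-- Okumura's inequality. -/
theorem sum_cube_le {ι : Type*} [Fintype ι] (t : ι → ℝ) (ht : ∑ i, t i = 0)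
    (hn : 2 ≤ Fintype.card ι) (s : ℝ) (hs : 0 ≤ s)
    (hT : ∑ i, t i ^ 2 = Fintype.card ι * ((Fintype.card ι : ℝ) - 1) * s ^ 2) :
    ∑ i, t i ^ 3 ≤ ((Fintype.card ι : ℝ) - 2) * s * ∑ i, t i ^ 2 := by
  classical
  set n : ℝ := ((Fintype.card ι : ℕ) : ℝ) with hn'
  have hn2 : (2 : ℝ) ≤ n := by rw [hn']; exact_mod_cast hn
  -- Cauchy–Schwarz for the other n - 1 entries, whose sum is -t i.
  have hle : ∀ i, t i ≤ (n - 1) * s := by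
    intro i
    have hcs := sq_sum_le_card_mul_sum_sq (s := Finset.univ.erase i) (f := t)
    have e1 := Finset.add_sum_erase Finset.univ t (Finset.mem_univ i)
    have e2 := Finset.add_sum_erase Finset.univ (fun j => t j ^ 2) (Finset.mem_univ i)
    have hc : ((Finset.univ.erase i).card : ℝ) = n - 1 := by
      rw [Finset.card_erase_of_mem (Finset.mem_univ i), Finset.card_univ, Nat.cast_sub (by omega)]
      simp [hn']
    rw [hc] at hcs
    rw [ht] at e1
    rw [hT] at e2
    have e3 : ∑ j ∈ Finset.univ.erase i, t j = - t i := by linarith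
    have e4 : ∑ j ∈ Finset.univ.erase i, t j ^ 2 = n * (n - 1) * s ^ 2 - t i ^ 2 := by
      linarith
    rw [e3, e4] at hcs
    have : n * t i ^ 2 ≤ n * ((n - 1) * s) ^ 2 := by nlinarith
    have h5 : t i ^ 2 ≤ ((n - 1) * s) ^ 2 := le_of_mul_le_mul_left this (by linarith)
    exact (le_abs_self _).trans (abs_le_of_sq_le_sq h5 (by apply mul_nonneg <;> linarith))
  -- Each summand vanishes in the extremal configuration: one entry (n - 1)s and all others -s.
  have hsum : ∑ i, (t i + s) ^ 2 * (t i - (n - 1) * s) ≤ 0 :=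
    Finset.sum_nonpos fun i _ => mul_nonpos_of_nonneg_of_nonpos (sq_nonneg _) (by linarith [hle i])
  have hexp : ∑ i, (t i + s) ^ 2 * (t i - (n - 1) * s) = ∑ i, t i ^ 3 -
      (n - 3) * s * ∑ i, t i ^ 2 + (s ^ 2 - 2 * (n - 1) * s ^ 2) * ∑ i, t i
      - n * ((n - 1) * s ^ 3) := by
    have hc : ∑ _i : ι, (n - 1) * s ^ 3 = n * ((n - 1) * s ^ 3) := by simp [hn']
    rw [← hc, Finset.mul_sum, Finset.mul_sum, ← Finset.sum_sub_distrib, ← Finset.sum_add_distrib,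
      ← Finset.sum_sub_distrib]
    exact Finset.sum_congr rfl fun i _ => by ring
  rw [hexp, ht] at hsum
  have : (n - 2) * s * ∑ i, t i ^ 2 = (n - 3) * s * ∑ i, t i ^ 2 + n * ((n - 1) * s ^ 3) := by
    rw [hT]; ring
  linarith

/-- Put t_i = l_i - m with m the mean, and T = ∑ t_i². The hypothesis `h2` says T ≤ n(n-1)m², i.e. s
≤ m in Okumura's inequality, so ∑ t_i³ ≤ (n-2)mT. Hence the sum on the right is at least m(n(n-1)m²
- T), and n times this is exactly the left side. -/
theorem sum_mul_sub_le_card_mul_sum {ι : Type*} [Fintype ι] (l : ι → ℝ)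
    (hn : 2 ≤ Fintype.card ι) (h1 : 0 ≤ ∑ i, l i) (h2 : ∑ i, l i ^ 2 ≤ (∑ i, l i) ^ 2) :
    (∑ i, l i) * ((∑ i, l i) ^ 2 - ∑ i, l i ^ 2) ≤
      Fintype.card ι * ∑ i, l i ^ 2 * ((∑ j, l j) - l i) := by
  set n : ℝ := ((Fintype.card ι : ℕ) : ℝ) with hn'
  have hn2 : (2 : ℝ) ≤ n := by rw [hn']; exact_mod_cast hn
  set p := ∑ i, l i with hp
  set m := p / n with hm
  have hpm : p = n * m := by rw [hm]; field_simp
  have hm0 : 0 ≤ m := div_nonneg h1 (by linarith)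
  set T := ∑ i, (l i - m) ^ 2 with hTdef
  have hT0 : 0 ≤ T := Finset.sum_nonneg fun i _ => sq_nonneg _
  have ht : ∑ i, (l i - m) = 0 := by
    rw [Finset.sum_sub_distrib, ← hp, hpm]; simp [hn']
  have hl2 : ∑ i, l i ^ 2 = T + n * m ^ 2 := by
    have : T = ∑ i, l i ^ 2 - 2 * m * p + n * m ^ 2 := by
      have hc : ∑ _i : ι, m ^ 2 = n * m ^ 2 := by simp [hn']
      rw [← hc, hp, Finset.mul_sum, ← Finset.sum_sub_distrib, ← Finset.sum_add_distrib]
      exact Finset.sum_congr rfl fun i _ => by ring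
    rw [this, hpm]; ring
  set s := √(T / (n * (n - 1))) with hs
  have hnn : 0 < n * (n - 1) := mul_pos (by linarith) (by linarith)
  have hs2 : T = n * (n - 1) * s ^ 2 := by
    rw [hs, Real.sq_sqrt (div_nonneg hT0 hnn.le), mul_div_cancel₀ _ hnn.ne']
  have hs0 : 0 ≤ s := Real.sqrt_nonneg _
  have hsm : s ≤ m := by
    apply le_of_sq_le_sq _ hm0
    have : n * (n - 1) * s ^ 2 ≤ n * (n - 1) * m ^ 2 := by
      rw [← hs2]; rw [hl2, hpm] at h2; nlinarith
    exact le_of_mul_le_mul_left this hnn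
  have hok := sum_cube_le (fun i => l i - m) ht hn s hs0 hs2
  have hok2 : ∑ i, (l i - m) ^ 3 ≤ (n - 2) * m * T := by
    refine hok.trans ?_
    rw [← hTdef]
    have : (n - 2) * s ≤ (n - 2) * m := mul_le_mul_of_nonneg_left hsm (by linarith)
    exact mul_le_mul_of_nonneg_right this hT0
  have hX : ∑ i, l i ^ 2 * (p - l i) = -∑ i, (l i - m) ^ 3 + (n - 3) * m * T +
      ((2 * n - 3) * m ^ 2) * ∑ i, (l i - m) + n * ((n - 1) * m ^ 3) := by
    have hc : ∑ _i : ι, (n - 1) * m ^ 3 = n * ((n - 1) * m ^ 3) := by simp [hn']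
    rw [← hc, hTdef, Finset.mul_sum, Finset.mul_sum, ← Finset.sum_neg_distrib,
      ← Finset.sum_add_distrib, ← Finset.sum_add_distrib, ← Finset.sum_add_distrib]
    exact Finset.sum_congr rfl fun i _ => by rw [hpm]; ring
  rw [hX, ht, hl2, hpm]
  nlinarith [mul_le_mul_of_nonneg_left hok2 (by linarith : (0:ℝ) ≤ n)]

end SymmetricFunctions

/-! ### Mollification of Lipschitz functions. -/

section Mollification

open Convolution in
/-- A Lipschitz function on a finite-dimensional inner product space is uniformly approximated by
smooth functions with the same Lipschitz constant. -/
theorem LipschitzWith.exists_contDiff_approx {V : Type*} [NormedAddCommGroup V]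
    [InnerProductSpace ℝ V] [FiniteDimensional ℝ V] {K : NNReal} {f : V → ℝ}
    (hf : LipschitzWith K f) {ε : ℝ} (hε : 0 < ε) :
    ∃ g : V → ℝ, ContDiff ℝ ∞ g ∧ LipschitzWith K g ∧ ∀ x, |g x - f x| ≤ ε := by
  let _ : MeasurableSpace V := borel V
  have _ : BorelSpace V := ⟨rfl⟩
  let μ : Measure V := Measure.addHaar
  -- On balls of this radius `f` varies by at most Kr ≤ ε; the 1 covers K = 0.
  set r : ℝ := ε / (K + 1) with hr
  have hr0 : 0 < r := by positivity
  let φ : ContDiffBump (0 : V) := ⟨r / 2, r, by positivity, by linarith⟩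
  have hint : ∀ x, Integrable (fun t => φ.normed μ t * f (x - t)) μ := fun x =>
    ((φ.continuous_normed).mul (hf.continuous.comp (by fun_prop))).integrable_of_hasCompactSupport
      (φ.hasCompactSupport_normed.mul_right)
  refine ⟨φ.normed μ ⋆[ContinuousLinearMap.lsmul ℝ ℝ, μ] f, ?_, ?_, ?_⟩
  · exact φ.hasCompactSupport_normed.contDiff_convolution_left _ φ.contDiff_normed
      hf.continuous.locallyIntegrable
  · apply LipschitzWith.of_dist_le_mul
    intro x y
    rw [Real.dist_eq]
    simp only [MeasureTheory.convolution, ContinuousLinearMap.lsmul_apply, smul_eq_mul]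
    rw [← integral_sub (hint x) (hint y), ← Real.norm_eq_abs]
    have hb : ∀ t, ‖φ.normed μ t * f (x - t) - φ.normed μ t * f (y - t)‖ ≤
        φ.normed μ t * (K * dist x y) := by
      intro t
      rw [← mul_sub, norm_mul, Real.norm_of_nonneg (φ.nonneg_normed t)]
      refine mul_le_mul_of_nonneg_left ?_ (φ.nonneg_normed t)
      have := hf.dist_le_mul (x - t) (y - t)
      rwa [Real.dist_eq, dist_sub_right] at this
    refine (norm_integral_le_of_norm_le (φ.integrable_normed.mul_const _)
      (Eventually.of_forall hb)).trans ?_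
    rw [integral_mul_const, φ.integral_normed, one_mul]
  · intro x
    rw [← Real.dist_eq]
    apply φ.dist_normed_convolution_le hf.continuous.aestronglyMeasurable
    intro y hy
    refine (hf.dist_le_mul y x).trans ?_
    have h1 : dist y x ≤ r := (Metric.mem_ball.1 hy).le
    calc (K : ℝ) * dist y x ≤ (K + 1) * r := by
          apply mul_le_mul _ h1 dist_nonneg (by positivity); linarith
      _ = ε := by rw [hr]; field_simp

end Mollification

/-! ### Compactness of closed balls in complete length spaces. -/

section HopfRinow

/-- The Hopf–Rinow–Cohn-Vossen theorem: in a complete locally compact space in which points at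
distance `< a + b` have intermediate points, closed balls are compact. -/
theorem properSpace_of_complete_of_intermediate {X : Type*} [MetricSpace X] [CompleteSpace X]
    [LocallyCompactSpace X]
    (hX : ∀ (x y : X) (a b : ℝ), 0 < a → 0 < b → dist x y < a + b →
      ∃ z, dist x z < a ∧ dist z y < b) :
    ProperSpace X := by
  refine ⟨fun o r => ?_⟩
  by_contra hcon
  -- Continuity method: the supremum of the radii with compact ball is itself such a radius, by
  -- completeness, and can be exceeded, by local compactness.
  let A : Set ℝ := {s | 0 ≤ s ∧ IsCompact (Metric.closedBall o s)}
  have hA0 : (0 : ℝ) ∈ A := ⟨le_rfl, by simp⟩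
  have hmono : ∀ s t, s ≤ t → IsCompact (Metric.closedBall o t) → IsCompact (Metric.closedBall o s) :=
    fun s t hst ht => ht.of_isClosed_subset Metric.isClosed_closedBall
      (Metric.closedBall_subset_closedBall hst)
  have hAb : BddAbove A := ⟨r, fun s hs => by
    by_contra h
    exact hcon (hmono r s (not_le.1 h).le hs.2)⟩
  set R := sSup A with hR
  have hR0 : 0 ≤ R := le_csSup hAb hA0
  have hlt : ∀ s < R, IsCompact (Metric.closedBall o s) := by
    intro s hs
    obtain ⟨t, ht, hst⟩ := exists_lt_of_lt_csSup ⟨0, hA0⟩ hs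
    exact hmono s t hst.le ht.2
  have hRc : IsCompact (Metric.closedBall o R) := by
    refine isCompact_iff_totallyBounded_isComplete.2 ⟨?_, Metric.isClosed_closedBall.isComplete⟩
    rw [Metric.totallyBounded_iff]
    intro ε hε
    -- Every point of the closed `R`-ball is within ε/2 of the ball of radius R - ε/4, so an ε/2-net
    -- of the latter is an ε-net of the former. If R ≤ ε/2 the centre alone suffices.
    obtain ⟨F, hF, hFc⟩ :=
      Metric.totallyBounded_iff.1 (hlt (R - ε / 4) (by linarith)).totallyBounded (ε / 2)
        (by linarith)
    by_cases hRε : R ≤ ε / 2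
    · refine ⟨{o}, finite_singleton o, fun y hy => ?_⟩
      simp only [mem_singleton_iff, iUnion_iUnion_eq_left, Metric.mem_ball]
      linarith [Metric.mem_closedBall.1 hy]
    · refine ⟨F, hF, fun y hy => ?_⟩
      obtain ⟨z, hz1, hz2⟩ := hX o y (R - ε / 4) (ε / 2) (by linarith) (by linarith)
        (by rw [dist_comm]; linarith [Metric.mem_closedBall.1 hy])
      have hz : z ∈ Metric.closedBall o (R - ε / 4) := by
        rw [Metric.mem_closedBall, dist_comm]; exact hz1.le
      obtain ⟨w, hw, hzw⟩ := mem_iUnion₂.1 (hFc hz)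
      refine mem_iUnion₂.2 ⟨w, hw, ?_⟩
      rw [Metric.mem_ball] at hzw ⊢
      linarith [dist_triangle y z w, dist_comm z y]
  obtain ⟨K, hK, hKs⟩ := exists_compact_superset hRc
  obtain ⟨δ, hδ, hδK⟩ := hRc.exists_thickening_subset_open isOpen_interior hKs
  -- The radii `R` and 3δ/4 give the strict inequality R + δ/2 < R + 3δ/4 needed for an intermediate
  -- point. When R < δ/2, where `R` may be 0, the centre is already close enough.
  have : R + δ / 2 ∈ A := by
    refine ⟨by linarith, hK.of_isClosed_subset Metric.isClosed_closedBall fun y hy => ?_⟩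
    apply interior_subset
    apply hδK
    rw [Metric.mem_thickening_iff]
    by_cases hRδ : R < δ / 2
    · exact ⟨o, by simpa using hR0, by linarith [Metric.mem_closedBall.1 hy]⟩
    · obtain ⟨z, hz1, hz2⟩ := hX o y R (δ * 3 / 4) (by linarith) (by linarith)
        (by rw [dist_comm]; linarith [Metric.mem_closedBall.1 hy])
      exact ⟨z, by rw [Metric.mem_closedBall, dist_comm]; exact hz1.le,
        by rw [dist_comm]; linarith⟩
  linarith [le_csSup hAb this]

end HopfRinow

/-! ### Differentials in charts and their operator norms. -/

section RiemannianCharts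

theorem isContinuousRiemannianBundle_tangentSpace (n : ℕ) (M : Type*) [MetricSpace M]
    [ChartedSpace (EuclideanSpace ℝ (Fin n)) M] [IsManifold (𝓡 n) ∞ M]
    [RiemannianBundle (fun p : M => TangentSpace (𝓡 n) p)]
    [IsContMDiffRiemannianBundle (𝓡 n) ∞ (EuclideanSpace ℝ (Fin n))
      (fun p : M => TangentSpace (𝓡 n) p)] :
    IsContinuousRiemannianBundle (EuclideanSpace ℝ (Fin n))
      (fun p : M => TangentSpace (𝓡 n) p) := by
  obtain ⟨g, hg, h⟩ := IsContMDiffRiemannianBundle.exists_contMDiff (IB := 𝓡 n) (n := ∞)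
    (F := EuclideanSpace ℝ (Fin n)) (E := fun p : M => TangentSpace (𝓡 n) p)
  exact ⟨g, hg.continuous, h⟩

variable {n : ℕ} {M : Type*} [MetricSpace M]
    [ChartedSpace (EuclideanSpace ℝ (Fin n)) M]

/-- The differential of a function on `M` with values in a vector space. -/
def diff {F : Type*} [NormedAddCommGroup F] [NormedSpace ℝ F] (f : M → F) (p : M) :
    TangentSpace (𝓡 n) p →L[ℝ] F :=
  mfderiv (𝓡 n) 𝓘(ℝ, F) f p

variable [IsManifold (𝓡 n) ∞ M]

theorem diff_comp {F G : Type*} [NormedAddCommGroup F] [NormedSpace ℝ F] [NormedAddCommGroup G]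
    [NormedSpace ℝ G] {g : F → G} {f : M → F} {p : M} (hg : DifferentiableAt ℝ g (f p))
    (hf : MDifferentiableAt (𝓡 n) 𝓘(ℝ, F) f p) :
    diff (n := n) (g ∘ f) p = (fderiv ℝ g (f p)).comp (diff f p) := by
  have h := (hg.hasFDerivAt.hasMFDerivAt.comp p hf.hasMFDerivAt).mfderiv
  exact h

theorem diff_congr {F : Type*} [NormedAddCommGroup F] [NormedSpace ℝ F] {f g : M → F} {p : M}
    (h : f =ᶠ[𝓝 p] g) : diff (n := n) f p = diff g p := by
  ext X
  have h := h.mfderiv_eq (I := 𝓡 n) (I' := 𝓘(ℝ, F))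
  simp only [diff]
  rw [h]

theorem mdifferentiableAt_extChart {p q : M} (hq : q ∈ (chartAt (EuclideanSpace ℝ (Fin n)) p).source) :
    MDifferentiableAt (𝓡 n) 𝓘(ℝ, EuclideanSpace ℝ (Fin n)) (extChartAt (𝓡 n) p) q :=
  mdifferentiableAt_extChartAt hq

theorem contDiffAt_comp_extChartAt_symm {F : Type*} [NormedAddCommGroup F] [NormedSpace ℝ F]
    {f : M → F} (hf : ContMDiff (𝓡 n) 𝓘(ℝ, F) ∞ f) (p : M) {y : EuclideanSpace ℝ (Fin n)}
    (hy : y ∈ (extChartAt (𝓡 n) p).target) :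
    ContDiffAt ℝ ∞ (f ∘ (extChartAt (𝓡 n) p).symm) y := by
  have h := (hf.comp_contMDiffOn (contMDiffOn_extChartAt_symm (I := 𝓡 n) (n := ∞) p)).contDiffOn
  exact (h y hy).contDiffAt ((isOpen_extChartAt_target p).mem_nhds hy)

/-- The differential of `f` in terms of the derivative of `f` read in a chart. -/
theorem diff_eq_fderiv_comp_extChartAt {F : Type*} [NormedAddCommGroup F] [NormedSpace ℝ F]
    {f : M → F} (hf : ContMDiff (𝓡 n) 𝓘(ℝ, F) ∞ f) {p q : M}
    (hq : q ∈ (chartAt (EuclideanSpace ℝ (Fin n)) p).source) :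
    diff (n := n) f q = (fderiv ℝ (f ∘ (extChartAt (𝓡 n) p).symm) (extChartAt (𝓡 n) p q)).comp
      (diff (extChartAt (𝓡 n) p) q) := by
  have hq' : q ∈ (extChartAt (𝓡 n) p).source := by rwa [extChartAt_source]
  rw [← diff_comp ((contDiffAt_comp_extChartAt_symm hf p
    ((extChartAt (𝓡 n) p).map_source hq')).differentiableAt (by simp))
    (mdifferentiableAt_extChart hq)]
  apply diff_congr
  filter_upwards [(isOpen_extChartAt_source p).mem_nhds hq'] with z hz
  rw [Function.comp_apply, Function.comp_apply, (extChartAt (𝓡 n) p).left_inv hz]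

variable [RiemannianBundle (fun p : M => TangentSpace (𝓡 n) p)]
    [IsContMDiffRiemannianBundle (𝓡 n) ∞ (EuclideanSpace ℝ (Fin n))
      (fun p : M => TangentSpace (𝓡 n) p)]

/-- Normalising the chart at `p` by a linear map makes its derivative and that of its inverse
have norm `< 2` near `p`. -/
theorem exists_normalised_chart_deriv (p : M) :
    ∃ L : EuclideanSpace ℝ (Fin n) ≃L[ℝ] EuclideanSpace ℝ (Fin n),
      (∀ᶠ q in 𝓝 p, ‖(L : EuclideanSpace ℝ (Fin n) →L[ℝ] EuclideanSpace ℝ (Fin n)).comp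
        (diff (n := n) (extChartAt (𝓡 n) p) q)‖ < 2) ∧
      ∀ᶠ q in 𝓝 p, ‖((trivializationAt (EuclideanSpace ℝ (Fin n)) (TangentSpace (𝓡 n)) p).symmL
        ℝ q).comp (L.symm : EuclideanSpace ℝ (Fin n) →L[ℝ] EuclideanSpace ℝ (Fin n))‖ < 2 := by
  have _ := isContinuousRiemannianBundle_tangentSpace n M
  let e := trivializationAt (EuclideanSpace ℝ (Fin n)) (TangentSpace (𝓡 n)) p
  have hp : p ∈ e.baseSet := FiberBundle.mem_baseSet_trivializationAt' p
  have hfr : Module.finrank ℝ (TangentSpace (𝓡 n) p) = n :=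
    finrank_euclideanSpace_fin (𝕜 := ℝ) (n := n)
  let b : OrthonormalBasis (Fin n) ℝ (TangentSpace (𝓡 n) p) :=
    (stdOrthonormalBasis ℝ (TangentSpace (𝓡 n) p)).reindex (finCongr hfr)
  -- With this `L`, the normalised chart has isometric differential at `p`. Continuity of the metric
  -- then gives any bound larger than 1 near `p`.
  let L : EuclideanSpace ℝ (Fin n) ≃L[ℝ] EuclideanSpace ℝ (Fin n) :=
    (e.continuousLinearEquivAt ℝ p hp).symm.trans b.repr.toContinuousLinearEquiv
  have hL : ∀ v, L v = b.repr (e.symmL ℝ p v) := fun v => by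
    change b.repr ((e.continuousLinearEquivAt ℝ p hp).symm v) = _
    rw [Trivialization.symm_continuousLinearEquivAt_eq _ hp]
  have hLs : ∀ v, L.symm v = e.continuousLinearMapAt ℝ p (b.repr.symm v) := fun v => by
    change e.continuousLinearEquivAt ℝ p hp (b.repr.symm v) = _
    rw [Trivialization.coe_continuousLinearEquivAt_eq _ hp]
  refine ⟨L, ?_, ?_⟩
  · filter_upwards [eventually_norm_symmL_trivializationAt_self_comp_lt (EuclideanSpace ℝ (Fin n))
      (fun p : M => TangentSpace (𝓡 n) p) p one_lt_two,
      (chartAt (EuclideanSpace ℝ (Fin n)) p).open_source.mem_nhds (mem_chart_source _ p)]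
      with q hq hqs
    refine lt_of_le_of_lt (ContinuousLinearMap.opNorm_le_bound _ (norm_nonneg _) fun X => ?_) hq
    have := ContinuousLinearMap.le_opNorm ((trivializationAt (EuclideanSpace ℝ (Fin n))
      (fun p : M => TangentSpace (𝓡 n) p) p).symmL ℝ p ∘SL (trivializationAt
      (EuclideanSpace ℝ (Fin n)) (fun p : M => TangentSpace (𝓡 n) p) p).continuousLinearMapAt ℝ q) X
    refine le_trans (le_of_eq ?_) this
    rw [TangentBundle.continuousLinearMapAt_trivializationAt hqs]
    rw [ContinuousLinearMap.comp_apply, ContinuousLinearEquiv.coe_coe, hL,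
      LinearIsometryEquiv.norm_map]
    rfl
  · filter_upwards [eventually_norm_symmL_trivializationAt_comp_self_lt
      (EuclideanSpace ℝ (Fin n)) (fun p : M => TangentSpace (𝓡 n) p) p one_lt_two] with q hq
    refine lt_of_le_of_lt (ContinuousLinearMap.opNorm_le_bound _ (norm_nonneg _) fun X => ?_) hq
    have := ContinuousLinearMap.le_opNorm ((trivializationAt (EuclideanSpace ℝ (Fin n))
      (fun p : M => TangentSpace (𝓡 n) p) p).symmL ℝ q ∘SL (trivializationAt
      (EuclideanSpace ℝ (Fin n)) (fun p : M => TangentSpace (𝓡 n) p) p).continuousLinearMapAt ℝ p)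
      (b.repr.symm X)
    rw [LinearIsometryEquiv.norm_map] at this
    refine le_trans (le_of_eq ?_) this
    simp only [ContinuousLinearMap.comp_apply, ContinuousLinearEquiv.coe_coe, hLs]
    rfl

end RiemannianCharts

/-! ### Comparison of Riemannian and Euclidean distance. -/

section RiemannianDistance

variable {n : ℕ} {M : Type*} [MetricSpace M]
    [ChartedSpace (EuclideanSpace ℝ (Fin n)) M] [IsManifold (𝓡 n) ∞ M]
    [RiemannianBundle (fun p : M => TangentSpace (𝓡 n) p)]
    [IsContMDiffRiemannianBundle (𝓡 n) ∞ (EuclideanSpace ℝ (Fin n))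
      (fun p : M => TangentSpace (𝓡 n) p)]
    [IsRiemannianManifold (𝓡 n) M]

/-- Every point has a linearly normalised chart with `2`-Lipschitz inverse and with derivative
bounded by `2`. -/
theorem exists_lipschitz_chart (p : M) :
    ∃ (L : EuclideanSpace ℝ (Fin n) ≃L[ℝ] EuclideanSpace ℝ (Fin n)) (r : ℝ), 0 < r ∧
      (∀ y ∈ Metric.ball (L (extChartAt (𝓡 n) p p)) r, L.symm y ∈ (extChartAt (𝓡 n) p).target) ∧
      LipschitzOnWith 2 (fun y => (extChartAt (𝓡 n) p).symm (L.symm y))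
        (Metric.ball (L (extChartAt (𝓡 n) p p)) r) ∧
      ∀ q ∈ (chartAt (EuclideanSpace ℝ (Fin n)) p).source,
        L (extChartAt (𝓡 n) p q) ∈ Metric.ball (L (extChartAt (𝓡 n) p p)) r →
        ‖(L : EuclideanSpace ℝ (Fin n) →L[ℝ] EuclideanSpace ℝ (Fin n)).comp
          (diff (n := n) (extChartAt (𝓡 n) p) q)‖ ≤ 2 := by
  obtain ⟨L, hL1, hL2⟩ := exists_normalised_chart_deriv (n := n) p
  set e := extChartAt (𝓡 n) p with he
  have hcont : ContinuousAt (fun y => e.symm (L.symm y)) (L (e p)) := by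
    apply ContinuousAt.comp (g := e.symm)
    · rw [L.symm_apply_apply]
      exact continuousAt_extChartAt_symm p
    · exact L.symm.continuous.continuousAt
  have hval : e.symm (L.symm (L (e p))) = p := by
    rw [L.symm_apply_apply]; exact extChartAt_to_inv p
  have ht : Tendsto (fun y => e.symm (L.symm y)) (𝓝 (L (e p))) (𝓝 p) := by
    have := hcont.tendsto
    rwa [hval] at this
  have h1 := ht.eventually (hL1.and hL2)
  have h2 : ∀ᶠ y in 𝓝 (L (e p)), L.symm y ∈ e.target := by
    apply L.symm.continuous.continuousAt.eventually_mem
    rw [L.symm_apply_apply]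
    exact extChartAt_target_mem_nhds p
  obtain ⟨r, hr, hball⟩ := Metric.eventually_nhds_iff_ball.1 (h1.and h2)
  refine ⟨L, r, hr, fun y hy => (hball y hy).2, ?_, ?_⟩
  · intro u hu v hv
    rw [IsRiemannianManifold.out (I := 𝓡 n)]
    -- The lift of the segment from `u` to `v`, which stays in the convex ball; its length in M is
    -- at most twice the Euclidean one.
    let η := ContinuousAffineMap.lineMap (R := ℝ) (L.symm u) (L.symm v)
    have hη : ∀ t ∈ Icc (0 : ℝ) 1, L (η t) ∈ Metric.ball (L (e p)) r := by
      intro t ht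
      have : L (η t) = AffineMap.lineMap u v t := by
        simp [η, ContinuousAffineMap.coe_lineMap_eq, AffineMap.lineMap_apply]
      rw [this]
      exact (convex_ball _ _).lineMap_mem hu hv ht
    have hη' : ∀ t ∈ Icc (0 : ℝ) 1, η t ∈ e.target := by
      intro t ht
      have := (hball _ (hη t ht)).2
      rwa [L.symm_apply_apply] at this
    have η_smooth : ContMDiffOn 𝓘(ℝ, ℝ) 𝓘(ℝ, EuclideanSpace ℝ (Fin n)) 1 η (Icc 0 1) := by
      apply ContMDiff.contMDiffOn
      rw [contMDiff_iff_contDiff]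
      exact ContinuousAffineMap.contDiff _
    have hle : riemannianEDist (𝓡 n) (e.symm (L.symm u)) (e.symm (L.symm v)) ≤
        pathELength (𝓡 n) (e.symm ∘ η) 0 1 := by
      apply riemannianEDist_le_pathELength _ _ _ zero_le_one
      · exact (contMDiffOn_extChartAt_symm p).comp η_smooth hη'
      · simp [η, ContinuousAffineMap.coe_lineMap_eq]
      · simp [η, ContinuousAffineMap.coe_lineMap_eq]
    refine hle.trans ?_
    rw [← lintegral_fderiv_lineMap_eq_edist, pathELength_eq_lintegral_mfderivWithin_Icc,
      ← lintegral_const_mul' _ _ ENNReal.coe_ne_top]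
    apply setLIntegral_mono' measurableSet_Icc (fun t ht ↦ ?_)
    have hc : mfderivWithin 𝓘(ℝ, ℝ) (𝓡 n) (e.symm ∘ η) (Icc 0 1) t =
        (mfderivWithin 𝓘(ℝ, EuclideanSpace ℝ (Fin n)) (𝓡 n) e.symm (range (𝓡 n)) (η t)) ∘L
          (mfderivWithin 𝓘(ℝ, ℝ) 𝓘(ℝ, EuclideanSpace ℝ (Fin n)) η (Icc 0 1) t) := by
      apply mfderivWithin_comp
      · exact mdifferentiableWithinAt_extChartAt_symm (hη' t ht)
      · exact η_smooth.mdifferentiableOn one_ne_zero t ht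
      · intro s _; simp
      · rw [uniqueMDiffWithinAt_iff_uniqueDiffWithinAt]
        exact uniqueDiffOn_Icc zero_lt_one t ht
    have hc1 : mfderivWithin 𝓘(ℝ, ℝ) (𝓡 n) (e.symm ∘ η) (Icc 0 1) t 1 =
        (mfderivWithin 𝓘(ℝ, EuclideanSpace ℝ (Fin n)) (𝓡 n) e.symm (range (𝓡 n)) (η t))
          (mfderivWithin 𝓘(ℝ, ℝ) 𝓘(ℝ, EuclideanSpace ℝ (Fin n)) η (Icc 0 1) t 1) :=
      congr($hc 1)
    have hη1 : mfderivWithin 𝓘(ℝ, ℝ) 𝓘(ℝ, EuclideanSpace ℝ (Fin n)) η (Icc 0 1) t 1 =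
        L.symm (v - u) := by
      rw [mfderivWithin_eq_fderivWithin, fderivWithin_eq_fderiv (uniqueDiffOn_Icc zero_lt_one _ ht)
        (ContinuousAffineMap.differentiableAt _), map_sub]
      change fderiv ℝ (ContinuousAffineMap.lineMap (R := ℝ) (L.symm u) (L.symm v)) t 1 = _
      simp
    have hq : e.symm (η t) ∈ (chartAt (EuclideanSpace ℝ (Fin n)) p).source := by
      have := e.map_target (hη' t ht)
      rwa [he, extChartAt_source] at this
    have hb := (hball _ (hη t ht)).1.2.le
    rw [L.symm_apply_apply, TangentBundle.symmL_trivializationAt hq, ← he,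
      e.right_inv (hη' t ht)] at hb
    have hb2 := ContinuousLinearMap.le_of_opNorm_le _ hb (v - u)
    have hη2 : fderivWithin ℝ (ContinuousAffineMap.lineMap (R := ℝ) u v) (Icc 0 1) t 1 = v - u := by
      rw [fderivWithin_eq_fderiv (uniqueDiffOn_Icc zero_lt_one _ ht)
        (ContinuousAffineMap.differentiableAt _)]
      simp
    rw [hc1, hη1, hη2, ← ofReal_norm, ← ofReal_norm, show ((2 : NNReal) : ENNReal) =
      ENNReal.ofReal 2 by simp, ← ENNReal.ofReal_mul zero_le_two]
    exact ENNReal.ofReal_le_ofReal hb2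
  · intro q hq hqb
    have := (hball _ hqb).1.1.le
    have hq' : q ∈ e.source := by rwa [he, extChartAt_source]
    rwa [L.symm_apply_apply, e.left_inv hq'] at this

/-- A smooth map with bounded differential is Lipschitz for the Riemannian distance. -/
theorem lipschitzWith_of_norm_diff_le {F : Type*} [NormedAddCommGroup F] [NormedSpace ℝ F]
    {f : M → F} (hf : ContMDiff (𝓡 n) 𝓘(ℝ, F) ∞ f) {C : NNReal}
    (hC : ∀ q, ‖diff (n := n) f q‖ ≤ C) : LipschitzWith C f := by
  intro x y
  rw [IsRiemannianManifold.out (I := 𝓡 n) x y]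
  have key : ∀ r, riemannianEDist (𝓡 n) x y < r → edist (f x) (f y) ≤ C * r := by
    intro r hr
    obtain ⟨γ, hγx, hγy, γ_smooth, hγ⟩ := exists_lt_of_riemannianEDist_lt hr
    have hfγ : ContMDiffOn 𝓘(ℝ, ℝ) 𝓘(ℝ, F) 1 (f ∘ γ) (Icc 0 1) :=
      (hf.of_le (by simp)).comp_contMDiffOn γ_smooth
    calc edist (f x) (f y) = ‖(f ∘ γ) 1 - (f ∘ γ) 0‖ₑ := by
          rw [edist_comm, edist_eq_enorm_sub]; simp [hγx, hγy]
      _ ≤ ∫⁻ t in Icc 0 1, ‖derivWithin (f ∘ γ) (Icc 0 1) t‖ₑ := by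
          apply enorm_sub_le_lintegral_derivWithin_Icc_of_contDiffOn_Icc _ zero_le_one
          rwa [← contMDiffOn_iff_contDiffOn]
      _ ≤ ∫⁻ t in Icc 0 1, C * ‖mfderivWithin 𝓘(ℝ, ℝ) (𝓡 n) γ (Icc 0 1) t 1‖ₑ := by
          apply setLIntegral_mono' measurableSet_Icc (fun t ht ↦ ?_)
          have hc : mfderivWithin 𝓘(ℝ, ℝ) 𝓘(ℝ, F) (f ∘ γ) (Icc 0 1) t =
              (mfderiv (𝓡 n) 𝓘(ℝ, F) f (γ t)) ∘L
                (mfderivWithin 𝓘(ℝ, ℝ) (𝓡 n) γ (Icc 0 1) t) := by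
            apply mfderiv_comp_mfderivWithin
            · exact hf.mdifferentiableAt (by simp)
            · exact γ_smooth.mdifferentiableOn one_ne_zero t ht
            · rw [uniqueMDiffWithinAt_iff_uniqueDiffWithinAt]
              exact uniqueDiffOn_Icc zero_lt_one t ht
          have hc1 : derivWithin (f ∘ γ) (Icc 0 1) t =
              diff (n := n) f (γ t) (mfderivWithin 𝓘(ℝ, ℝ) (𝓡 n) γ (Icc 0 1) t 1) := by
            rw [← fderivWithin_derivWithin, ← mfderivWithin_eq_fderivWithin]
            exact congr($hc 1)
          rw [hc1]
          refine (ContinuousLinearMap.le_opENorm _ _).trans ?_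
          gcongr
          rw [enorm_le_coe]
          exact_mod_cast hC (γ t)
      _ = C * pathELength (𝓡 n) γ 0 1 := by
          rw [lintegral_const_mul' _ _ ENNReal.coe_ne_top,
            pathELength_eq_lintegral_mfderivWithin_Icc]
      _ ≤ C * r := by gcongr
  -- Letting `r` decrease to the distance requires dividing by `C`; for C = 0 the choice r = ⊤ is
  -- enough, since 0 · ⊤ = 0.
  by_cases hC0 : C = 0
  · have hr : riemannianEDist (𝓡 n) x y < ⊤ := by
      rw [← IsRiemannianManifold.out (I := 𝓡 n) x y]; exact edist_lt_top x y
    simpa [hC0] using key _ hr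
  · have hC0' : (C : ENNReal) ≠ 0 := by simpa using hC0
    rw [mul_comm, ← ENNReal.div_le_iff_le_mul (Or.inl hC0') (Or.inl ENNReal.coe_ne_top)]
    refine le_of_forall_gt_imp_ge_of_dense fun r hr => ?_
    rw [ENNReal.div_le_iff_le_mul (Or.inl hC0') (Or.inl ENNReal.coe_ne_top), mul_comm]
    exact key r hr

end RiemannianDistance

/-- Points at Riemannian distance `< a + b` have intermediate points. -/
theorem exists_intermediate_point (n : ℕ) {M : Type*} [MetricSpace M]
    [ChartedSpace (EuclideanSpace ℝ (Fin n)) M] [IsManifold (𝓡 n) ∞ M]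
    [RiemannianBundle (fun p : M => TangentSpace (𝓡 n) p)]
    [IsRiemannianManifold (𝓡 n) M] (x y : M) (a b : ℝ) (ha : 0 < a) (hb : 0 < b)
    (h : dist x y < a + b) : ∃ z, dist x z < a ∧ dist z y < b := by
  have hr : riemannianEDist (𝓡 n) x y < ENNReal.ofReal (a + b) := by
    rw [← IsRiemannianManifold.out (I := 𝓡 n) x y, edist_dist]
    exact (ENNReal.ofReal_lt_ofReal_iff (by linarith)).2 h
  obtain ⟨γ, hγx, hγy, γ_smooth, hγ⟩ := exists_lt_of_riemannianEDist_lt hr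
  have hγfin : pathELength (𝓡 n) γ 0 1 ≠ ⊤ := (hγ.trans ENNReal.ofReal_lt_top).ne
  have hlen : (pathELength (𝓡 n) γ 0 1).toReal < a + b := by
    rw [← ENNReal.ofReal_lt_ofReal_iff (by linarith), ENNReal.ofReal_toReal hγfin]
    exact hγ
  have hlen0 : 0 ≤ (pathELength (𝓡 n) γ 0 1).toReal := ENNReal.toReal_nonneg
  -- A point of the curve at distance exactly `a'` from `x` leaves less than `b` for the rest of the
  -- curve. If `y` is within `a'` of `x`, then `y` itself serves.
  obtain ⟨a', ha'1, ha'2⟩ : ∃ a', max 0 ((pathELength (𝓡 n) γ 0 1).toReal - b) < a' ∧ a' < a :=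
    exists_between (max_lt ha (by linarith))
  have ha'0 : 0 < a' := (le_max_left _ _).trans_lt ha'1
  have ha'b := (le_max_right _ _).trans_lt ha'1
  by_cases hxy : dist x y ≤ a'
  · exact ⟨y, hxy.trans_lt ha'2, by simpa using hb⟩
  have hc : ContinuousOn (fun t => dist x (γ t)) (Icc 0 1) :=
    (continuous_const.dist continuous_id).comp_continuousOn γ_smooth.continuousOn
  obtain ⟨t, ht, hxt⟩ := intermediate_value_Icc zero_le_one hc
    (show a' ∈ Icc (dist x (γ 0)) (dist x (γ 1)) by
      rw [hγx, hγy, dist_self]; exact ⟨ha'0.le, (not_le.1 hxy).le⟩)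
  have h1 : edist x (γ t) ≤ pathELength (𝓡 n) γ 0 t := by
    rw [IsRiemannianManifold.out (I := 𝓡 n)]
    exact riemannianEDist_le_pathELength (γ_smooth.mono (Icc_subset_Icc_right ht.2)) hγx rfl ht.1
  have h2 : edist (γ t) y ≤ pathELength (𝓡 n) γ t 1 := by
    rw [IsRiemannianManifold.out (I := 𝓡 n)]
    exact riemannianEDist_le_pathELength (γ_smooth.mono (Icc_subset_Icc_left ht.1)) rfl hγy ht.2
  have h3 : edist x (γ t) + edist (γ t) y ≤ pathELength (𝓡 n) γ 0 1 := by
    rw [← pathELength_add ht.1 ht.2]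
    exact add_le_add h1 h2
  have h4 : dist x (γ t) + dist (γ t) y ≤ (pathELength (𝓡 n) γ 0 1).toReal := by
    rw [dist_edist, dist_edist, ← ENNReal.toReal_add (edist_ne_top _ _) (edist_ne_top _ _)]
    exact ENNReal.toReal_mono hγfin h3
  simp only at hxt
  exact ⟨γ t, hxt.trans_lt ha'2, by linarith⟩

theorem properSpace_of_complete (n : ℕ) (M : Type*) [MetricSpace M]
    [ChartedSpace (EuclideanSpace ℝ (Fin n)) M] [IsManifold (𝓡 n) ∞ M]
    [RiemannianBundle (fun p : M => TangentSpace (𝓡 n) p)]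
    [IsRiemannianManifold (𝓡 n) M] [CompleteSpace M] : ProperSpace M := by
  have : LocallyCompactSpace M := ChartedSpace.locallyCompactSpace (EuclideanSpace ℝ (Fin n)) M
  exact properSpace_of_complete_of_intermediate (exists_intermediate_point n)

/-! ### Differentials of finite sums and products. -/

section Differentials

variable {n : ℕ} {M : Type*} [MetricSpace M]
    [ChartedSpace (EuclideanSpace ℝ (Fin n)) M] [IsManifold (𝓡 n) ∞ M]

theorem diff_zero {F : Type*} [NormedAddCommGroup F] [NormedSpace ℝ F] (p : M) :
    diff (n := n) (fun _ : M => (0 : F)) p = 0 := by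
  exact mfderiv_const

theorem hasMFDerivAt_sum {ι : Type*} {t : Finset ι} {f : ι → M → ℝ} {p : M}
    {f' : ι → TangentSpace (𝓡 n) p →L[ℝ] ℝ}
    (hf : ∀ i ∈ t, HasMFDerivAt (𝓡 n) 𝓘(ℝ, ℝ) (f i) p (f' i)) :
    HasMFDerivAt (𝓡 n) 𝓘(ℝ, ℝ) (∑ i ∈ t, f i) p (∑ i ∈ t, f' i) := by
  classical
  induction t using Finset.induction_on with
  | empty => simpa using! hasMFDerivAt_const ..
  | insert i s hi IH =>
    have h := (hf i (Finset.mem_insert_self i s)).add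
      (IH fun j hj => hf j (Finset.mem_insert_of_mem hj))
    have e1 := Finset.sum_insert (f := f) hi
    have e2 := Finset.sum_insert (f := f') hi
    have h1 : HasMFDerivAt (𝓡 n) 𝓘(ℝ, ℝ) (∑ i ∈ insert i s, f i) p (f' i + ∑ i ∈ s, f' i) := by
      rw [e1]; exact h
    rw [← e2] at h1
    exact h1

theorem diff_sum_mul {ι : Type*} [Fintype ι] {f g : ι → M → ℝ}
    (hf : ∀ i, ContMDiff (𝓡 n) 𝓘(ℝ, ℝ) ∞ (f i)) (hg : ∀ i, ContMDiff (𝓡 n) 𝓘(ℝ, ℝ) ∞ (g i))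
    (p : M) : diff (n := n) (fun q => ∑ i, f i q * g i q) p =
      ∑ i, (f i p • diff (n := n) (g i) p + g i p • diff (n := n) (f i) p) := by
  have h0 : ∀ i ∈ Finset.univ, HasMFDerivAt (𝓡 n) 𝓘(ℝ, ℝ) (f i * g i) p
      (f i p • diff (n := n) (g i) p + g i p • diff (n := n) (f i) p) := fun i _ =>
    (((hf i).mdifferentiableAt (x := p) (by simp)).hasMFDerivAt).mul
      (((hg i).mdifferentiableAt (x := p) (by simp)).hasMFDerivAt)
  have h := hasMFDerivAt_sum h0
  have h2 : (∑ i, f i * g i) = fun q => ∑ i, f i q * g i q := by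
    ext q; simp
  rw [h2] at h
  exact h.mfderiv

theorem diff_sum {ι : Type*} [Fintype ι] {f : ι → M → ℝ}
    (hf : ∀ i, ContMDiff (𝓡 n) 𝓘(ℝ, ℝ) ∞ (f i)) (p : M) :
    diff (n := n) (fun q => ∑ i, f i q) p = ∑ i, diff (n := n) (f i) p := by
  have h0 : ∀ i ∈ Finset.univ, HasMFDerivAt (𝓡 n) 𝓘(ℝ, ℝ) (f i) p (diff (n := n) (f i) p) :=
    fun i _ => ((hf i).mdifferentiableAt (x := p) (by simp)).hasMFDerivAt
  have h := hasMFDerivAt_sum h0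
  have h2 : (∑ i, f i) = fun q => ∑ i, f i q := by
    ext q; simp
  rw [h2] at h
  exact h.mfderiv

end Differentials

/-! ### Local bounds for differentials. -/

section LocalBounds

variable {n : ℕ} {M : Type*} [MetricSpace M]
    [ChartedSpace (EuclideanSpace ℝ (Fin n)) M] [IsManifold (𝓡 n) ∞ M]
    [RiemannianBundle (fun p : M => TangentSpace (𝓡 n) p)]
    [IsContMDiffRiemannianBundle (𝓡 n) ∞ (EuclideanSpace ℝ (Fin n))
      (fun p : M => TangentSpace (𝓡 n) p)]

/-- The norm of T_qM varies with q, so the differential is factored through the normalised chart: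
the derivative read in the chart is continuous, and the chart differential is bounded. -/
theorem exists_eventually_norm_diff_le {F : Type*} [NormedAddCommGroup F] [NormedSpace ℝ F]
    {f : M → F} (hf : ContMDiff (𝓡 n) 𝓘(ℝ, F) ∞ f) (p : M) :
    ∃ C, ∀ᶠ q in 𝓝 p, ‖diff (n := n) f q‖ ≤ C := by
  obtain ⟨L, hL, -⟩ := exists_normalised_chart_deriv (n := n) p
  have hc : ContinuousAt (fun q => ‖fderiv ℝ (f ∘ (extChartAt (𝓡 n) p).symm)
      (extChartAt (𝓡 n) p q)‖) p := by
    have h1 := ((contDiffAt_comp_extChartAt_symm hf p (mem_extChartAt_target p)).fderiv_right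
      (m := 0) (by simp)).continuousAt
    exact (h1.comp (continuousAt_extChartAt (I := 𝓡 n) p)).norm
  set a := ‖fderiv ℝ (f ∘ (extChartAt (𝓡 n) p).symm) (extChartAt (𝓡 n) p p)‖ with ha
  refine ⟨(a + 1) * (‖(L.symm : EuclideanSpace ℝ (Fin n) →L[ℝ] EuclideanSpace ℝ (Fin n))‖ * 2), ?_⟩
  filter_upwards [hc.eventually (gt_mem_nhds (lt_add_one a)), hL,
    (chartAt (EuclideanSpace ℝ (Fin n)) p).open_source.mem_nhds (mem_chart_source _ p)]
    with q h1 h2 h3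
  rw [diff_eq_fderiv_comp_extChartAt hf h3]
  refine (ContinuousLinearMap.opNorm_comp_le _ _).trans ?_
  have h4 : diff (n := n) (extChartAt (𝓡 n) p) q =
      (L.symm : EuclideanSpace ℝ (Fin n) →L[ℝ] EuclideanSpace ℝ (Fin n)).comp
      ((L : EuclideanSpace ℝ (Fin n) →L[ℝ] EuclideanSpace ℝ (Fin n)).comp
        (diff (n := n) (extChartAt (𝓡 n) p) q)) := by
    ext X; simp
  have h5 : ‖diff (n := n) (extChartAt (𝓡 n) p) q‖ ≤
      ‖(L.symm : EuclideanSpace ℝ (Fin n) →L[ℝ] EuclideanSpace ℝ (Fin n))‖ * 2 := by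
    rw [h4]
    refine (ContinuousLinearMap.opNorm_comp_le _ _).trans ?_
    gcongr
  gcongr

theorem exists_norm_diff_le_of_isCompact {F : Type*} [NormedAddCommGroup F] [NormedSpace ℝ F]
    {f : M → F} (hf : ContMDiff (𝓡 n) 𝓘(ℝ, F) ∞ f) {K : Set M} (hK : IsCompact K) :
    ∃ C : NNReal, ∀ q ∈ K, ‖diff (n := n) f q‖ ≤ C := by
  refine hK.induction_on (p := fun K => ∃ C : NNReal, ∀ q ∈ K, ‖diff (n := n) f q‖ ≤ C)
    ⟨0, by simp⟩ ?_ ?_ ?_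
  · rintro s t hst ⟨C, hC⟩
    exact ⟨C, fun q hq => hC q (hst hq)⟩
  · rintro s t ⟨C, hC⟩ ⟨D, hD⟩
    refine ⟨max C D, fun q hq => ?_⟩
    rcases hq with hq | hq
    · exact (hC q hq).trans (by exact_mod_cast le_max_left C D)
    · exact (hD q hq).trans (by exact_mod_cast le_max_right C D)
  · intro p _
    obtain ⟨C, hC⟩ := exists_eventually_norm_diff_le hf p
    refine ⟨_, mem_nhdsWithin_of_mem_nhds hC, ⟨C.toNNReal, fun q hq => ?_⟩⟩
    exact (show _ ≤ C from hq).trans (Real.le_coe_toNNReal C)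

theorem exists_norm_diff_le_of_hasCompactSupport {F : Type*} [NormedAddCommGroup F]
    [NormedSpace ℝ F] {f : M → F} (hf : ContMDiff (𝓡 n) 𝓘(ℝ, F) ∞ f) (hfc : HasCompactSupport f) :
    ∃ C : NNReal, ∀ q, ‖diff (n := n) f q‖ ≤ C := by
  obtain ⟨C, hC⟩ := exists_norm_diff_le_of_isCompact hf hfc.isCompact
  refine ⟨C, fun q => ?_⟩
  by_cases hq : q ∈ tsupport f
  · exact hC q hq
  · have h0 : diff (n := n) f q = 0 := by
      have h1 : f =ᶠ[𝓝 q] fun _ => (0 : F) := notMem_tsupport_iff_eventuallyEq.1 hq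
      rw [diff_congr h1, diff_zero]
    rw [h0]
    exact ContinuousLinearMap.opNorm_le_bound _ C.2 fun X => by simp; positivity

end LocalBounds

/-! ### The Hausdorff measure as a volume. -/

section Volume

variable {n : ℕ} {M : Type*} [MetricSpace M]
    [ChartedSpace (EuclideanSpace ℝ (Fin n)) M] [IsManifold (𝓡 n) ∞ M]
    [RiemannianBundle (fun p : M => TangentSpace (𝓡 n) p)]
    [IsContMDiffRiemannianBundle (𝓡 n) ∞ (EuclideanSpace ℝ (Fin n))
      (fun p : M => TangentSpace (𝓡 n) p)]
    [IsRiemannianManifold (𝓡 n) M]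

theorem euclideanHausdorffMeasure_image_le {X Y : Type*} [MetricSpace X] [MeasurableSpace X]
    [BorelSpace X] [MetricSpace Y] [MeasurableSpace Y] [BorelSpace Y] {K : NNReal} {f : X → Y}
    {s : Set X} (h : LipschitzOnWith K f s) (d : ℕ) :
    (μHE[d] : Measure Y) (f '' s) ≤ (K : ENNReal) ^ d * (μHE[d] : Measure X) s := by
  have := h.hausdorffMeasure_image_le (d := d) (by positivity)
  simp only [Measure.euclideanHausdorffMeasure_def, Measure.smul_apply, ENNReal.smul_def,
    smul_eq_mul]
  rw [mul_left_comm]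
  gcongr
  simpa using this

/-- Each point has a neighbourhood that is a 2-Lipschitz image of a Euclidean ball. -/
theorem isLocallyFiniteMeasure_volume (n : ℕ) (M : Type*) [MetricSpace M]
    [ChartedSpace (EuclideanSpace ℝ (Fin n)) M] [IsManifold (𝓡 n) ∞ M]
    [RiemannianBundle (fun p : M => TangentSpace (𝓡 n) p)]
    [IsContMDiffRiemannianBundle (𝓡 n) ∞ (EuclideanSpace ℝ (Fin n))
      (fun p : M => TangentSpace (𝓡 n) p)]
    [IsRiemannianManifold (𝓡 n) M] [MeasurableSpace M] [BorelSpace M] :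
    IsLocallyFiniteMeasure (μHE[n] : Measure M) := by
  refine ⟨fun p => ?_⟩
  obtain ⟨L, r, hr, htarget, hLip, -⟩ := exists_lipschitz_chart (n := n) p
  set e := extChartAt (𝓡 n) p with he
  refine ⟨(fun y => e.symm (L.symm y)) '' Metric.ball (L (e p)) r, ?_, ?_⟩
  · have hc : ContinuousAt (fun q => L (e q)) p :=
      L.continuous.continuousAt.comp (continuousAt_extChartAt (I := 𝓡 n) p)
    filter_upwards [hc (Metric.ball_mem_nhds _ hr), extChartAt_source_mem_nhds (I := 𝓡 n) p]
      with q h1 h2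
    exact ⟨L (e q), h1, by simp only [L.symm_apply_apply]; exact e.left_inv h2⟩
  · refine (euclideanHausdorffMeasure_image_le hLip n).trans_lt ?_
    rw [EuclideanSpace.euclideanHausdorffMeasure_eq_volume]
    exact ENNReal.mul_lt_top (by simp) Metric.isBounded_ball.measure_lt_top

/-- A chart multiplied by a bump function is globally Lipschitz. It would send a null open set to a
Lebesgue null set, but near `p` it is the chart, whose image contains a neighbourhood. -/
theorem isOpenPosMeasure_volume (n : ℕ) (M : Type*) [MetricSpace M]
    [ChartedSpace (EuclideanSpace ℝ (Fin n)) M] [IsManifold (𝓡 n) ∞ M]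
    [RiemannianBundle (fun p : M => TangentSpace (𝓡 n) p)]
    [IsContMDiffRiemannianBundle (𝓡 n) ∞ (EuclideanSpace ℝ (Fin n))
      (fun p : M => TangentSpace (𝓡 n) p)]
    [IsRiemannianManifold (𝓡 n) M] [MeasurableSpace M] [BorelSpace M] :
    (μHE[n] : Measure M).IsOpenPosMeasure := by
  refine ⟨fun U hU ⟨p, hp⟩ h0 => ?_⟩
  obtain ⟨f, -⟩ := (SmoothBumpFunction.nhds_basis_tsupport (I := 𝓡 n) p).ex_mem
  have hg : ContMDiff (𝓡 n) 𝓘(ℝ, EuclideanSpace ℝ (Fin n)) ∞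
      fun q => f q • extChartAt (𝓡 n) p q := f.contMDiff_smul contMDiffOn_extChartAt
  obtain ⟨C, hC⟩ := exists_norm_diff_le_of_hasCompactSupport hg f.hasCompactSupport.smul_right
  have hLip := lipschitzWith_of_norm_diff_le hg hC
  set W : Set M := U ∩ {q | f q = 1} with hW
  have hWp : W ∈ 𝓝 p := inter_mem (hU.mem_nhds hp) f.eventuallyEq_one
  have himg : (fun q => f q • extChartAt (𝓡 n) p q) '' W = extChartAt (𝓡 n) p '' W := by
    apply image_congr
    rintro q ⟨-, hq⟩
    simp only [mem_ofPred_eq] at hq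
    rw [hq, one_smul]
  have hopen : extChartAt (𝓡 n) p '' W ∈ 𝓝 (extChartAt (𝓡 n) p p) := by
    rw [← map_extChartAt_nhds_of_boundaryless]
    exact image_mem_map hWp
  have hle := euclideanHausdorffMeasure_image_le hLip.lipschitzOnWith (s := W) n
  rw [himg, EuclideanSpace.euclideanHausdorffMeasure_eq_volume,
    measure_mono_null inter_subset_left h0, mul_zero] at hle
  exact (Measure.measure_pos_of_mem_nhds volume hopen).ne' (le_antisymm hle bot_le)

end Volume

/-! ### Smoothing Lipschitz functions on M. -/

section SmoothApproximation

variable {n : ℕ} {M : Type*} [MetricSpace M]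
    [ChartedSpace (EuclideanSpace ℝ (Fin n)) M] [IsManifold (𝓡 n) ∞ M]
    [RiemannianBundle (fun p : M => TangentSpace (𝓡 n) p)]
    [IsContMDiffRiemannianBundle (𝓡 n) ∞ (EuclideanSpace ℝ (Fin n))
      (fun p : M => TangentSpace (𝓡 n) p)]
    [IsRiemannianManifold (𝓡 n) M]

/-- Read in a Lipschitz chart, `h` is 2-Lipschitz; it is extended to ℝⁿ and mollified with the same
constant. Pulling back costs another factor 2. That `U` does not depend on ε lets ε be chosen after
a partition of unity. -/
theorem exists_local_smooth_approx {h : M → ℝ} (hh : LipschitzWith 1 h) (p : M) :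
    ∃ U : Set M, IsOpen U ∧ p ∈ U ∧ ∀ ε > 0, ∃ ρ : M → ℝ, ContMDiff (𝓡 n) 𝓘(ℝ, ℝ) ∞ ρ ∧
      ∀ q ∈ U, |ρ q - h q| ≤ ε ∧ ‖diff (n := n) ρ q‖ ≤ 4 := by
  obtain ⟨L, r, hr, htarget, hLip, hder⟩ := exists_lipschitz_chart (n := n) p
  obtain ⟨f, -⟩ := (SmoothBumpFunction.nhds_basis_tsupport (I := 𝓡 n) p).ex_mem
  set e := extChartAt (𝓡 n) p with he
  set B := Metric.ball (L (e p)) r with hB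
  have hesmooth : ContMDiffOn (𝓡 n) 𝓘(ℝ, EuclideanSpace ℝ (Fin n)) ∞ e
      (chartAt (EuclideanSpace ℝ (Fin n)) p).source := contMDiffOn_extChartAt
  have hopen : IsOpen ((chartAt (EuclideanSpace ℝ (Fin n)) p).source ∩
      (fun q => L (e q)) ⁻¹' B) :=
    (L.continuous.comp_continuousOn hesmooth.continuousOn).isOpen_inter_preimage
      (chartAt (EuclideanSpace ℝ (Fin n)) p).open_source Metric.isOpen_ball
  refine ⟨interior {q | f q = 1} ∩ ((chartAt (EuclideanSpace ℝ (Fin n)) p).source ∩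
    (fun q => L (e q)) ⁻¹' B), isOpen_interior.inter hopen,
    ⟨mem_interior_iff_mem_nhds.2 f.eventuallyEq_one, mem_chart_source _ p,
      Metric.mem_ball_self hr⟩, fun ε hε => ?_⟩
  obtain ⟨G₀, hG₀, hG₀eq⟩ := (hh.comp_lipschitzOnWith hLip).extend_real
  obtain ⟨G, hGsmooth, hGLip, hGapprox⟩ := LipschitzWith.exists_contDiff_approx hG₀ hε
  have hsmooth : ContMDiff (𝓡 n) 𝓘(ℝ, ℝ) ∞ fun q => f q • (G ∘ L) (e q) :=
    f.contMDiff_smul ((hGsmooth.comp L.contDiff).contMDiff.comp_contMDiffOn hesmooth)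
  refine ⟨_, hsmooth, ?_⟩
  rintro q ⟨hq1, hq2, hq3⟩
  have hfq : q ∈ {q | f q = 1} := interior_subset hq1
  rw [mem_ofPred_eq] at hfq
  have hqs : q ∈ e.source := by rwa [he, extChartAt_source]
  constructor
  · have h1 := hG₀eq hq3
    simp only [Function.comp_apply, L.symm_apply_apply, e.left_inv hqs] at h1
    simp only [hfq, one_smul, Function.comp_apply]
    rw [h1]
    exact hGapprox _
  · have hev : (fun q => f q • (G ∘ L) (e q)) =ᶠ[𝓝 q] (G ∘ L) ∘ e := by
      filter_upwards [isOpen_interior.mem_nhds hq1] with z hz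
      have : z ∈ {z | f z = 1} := interior_subset hz
      rw [mem_ofPred_eq] at this
      simp [this]
    have hGd : DifferentiableAt ℝ G (L (e q)) := hGsmooth.differentiable (by simp) _
    rw [diff_congr hev, diff_comp ((hGd.comp _ L.differentiableAt)) (mdifferentiableAt_extChart hq2),
      fderiv_comp _ hGd L.differentiableAt, L.fderiv, ContinuousLinearMap.comp_assoc]
    refine (ContinuousLinearMap.opNorm_comp_le _ _).trans ?_
    have h1 : ‖fderiv ℝ G (L (e q))‖ ≤ 2 := by
      have := norm_fderiv_le_of_lipschitz ℝ (x₀ := L (e q)) hGLip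
      simpa using this
    have h2 := hder q hq2 hq3
    calc _ ≤ (2 : ℝ) * 2 := mul_le_mul h1 h2 (ContinuousLinearMap.opNorm_nonneg _) zero_le_two
      _ = 4 := by norm_num

/-- A `1`-Lipschitz function on a compact set is within `1` of a smooth function with differential
bounded by `5`. -/
theorem exists_smooth_approx [ProperSpace M] {h : M → ℝ} (hh : LipschitzWith 1 h) {K : Set M}
    (hK : IsCompact K) :
    ∃ g : M → ℝ, ContMDiff (𝓡 n) 𝓘(ℝ, ℝ) ∞ g ∧
      ∀ q ∈ interior K, |g q - h q| ≤ 1 ∧ ‖diff (n := n) g q‖ ≤ 5 := by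
  choose U hUo hpU happrox using exists_local_smooth_approx (n := n) hh
  obtain ⟨t, -, htK⟩ := hK.elim_nhds_subcover U fun p _ => (hUo p).mem_nhds (hpU p)
  obtain ⟨f, hf⟩ := SmoothPartitionOfUnity.exists_isSubordinate (𝓡 n) hK.isClosed
    (fun i : t => U i) (fun i => hUo i) (by simpa [iUnion_subtype] using htK)
  have hfs : ∀ i, ContMDiff (𝓡 n) 𝓘(ℝ, ℝ) ∞ (f i) := fun i => (f i).contMDiff
  choose C hC using fun i => exists_norm_diff_le_of_isCompact (hfs i) hK
  -- So small that the derivatives of the partition functions contribute at most ∑ C_i ε ≤ 1.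
  set ε : ℝ := 1 / (∑ i, (C i : ℝ) + 1) with hε
  have hCs : 0 ≤ ∑ i, (C i : ℝ) := Finset.sum_nonneg fun i _ => (C i).2
  have hε0 : 0 < ε := by positivity
  have hε1 : ε ≤ 1 := by
    rw [hε, div_le_one (by positivity)]; linarith
  have hεC : ∑ i, (C i : ℝ) * ε ≤ 1 := by
    rw [← Finset.sum_mul, hε, mul_one_div, div_le_one (by positivity)]; linarith
  choose ρ hρs hρ using fun i : t => happrox i ε hε0
  have hgs : ContMDiff (𝓡 n) 𝓘(ℝ, ℝ) ∞ fun q => ∑ i, f i q * ρ i q :=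
    contMDiff_finsetSum fun i _ => (hfs i).mul (hρs i)
  refine ⟨_, hgs, fun q hq => ?_⟩
  have hsum : ∀ z ∈ K, ∑ i, f i z = 1 := by
    intro z hz
    rw [← finsum_eq_sum_of_fintype]
    exact f.sum_eq_one hz
  have hqK : q ∈ K := interior_subset hq
  have hU : ∀ i, q ∈ tsupport (f i) → q ∈ U i := fun i hi => hf i hi
  constructor
  · have h1 : ∑ i, f i q * ρ i q - h q = ∑ i, f i q * (ρ i q - h q) := by
      simp only [mul_sub, Finset.sum_sub_distrib, ← Finset.sum_mul, hsum q hqK, one_mul]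
    rw [h1]
    calc |∑ i, f i q * (ρ i q - h q)| ≤ ∑ i, |f i q * (ρ i q - h q)| :=
          Finset.abs_sum_le_sum_abs _ _
      _ ≤ ∑ i, f i q * 1 := by
          refine Finset.sum_le_sum fun i _ => ?_
          rw [abs_mul, abs_of_nonneg (f.nonneg i q)]
          by_cases hi : f i q = 0
          · simp [hi]
          · have := (hρ i q (hU i (subset_closure hi))).1
            exact mul_le_mul_of_nonneg_left (this.trans hε1) (f.nonneg i q)
      _ = 1 := by simp only [mul_one]; exact hsum q hqK
  -- Since ∑ df_i = 0 near `q`, each ρ_i may be replaced by ρ_i - h(q) in the terms with df_i. The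
  -- bound is then 4 + 1.
  · have hdsum : ∑ i, diff (n := n) (f i) q = 0 := by
      rw [← diff_sum hfs]
      have h1 : (fun z => ∑ i, f i z) =ᶠ[𝓝 q] fun _ => (1 : ℝ) := by
        filter_upwards [isOpen_interior.mem_nhds hq] with z hz
        exact hsum z (interior_subset hz)
      rw [diff_congr h1]
      exact mfderiv_const
    rw [diff_sum_mul hfs hρs]
    refine ContinuousLinearMap.opNorm_le_bound _ (by norm_num) fun X => ?_
    have hX : (∑ i, (f i q • diff (n := n) (ρ i) q + ρ i q • diff (n := n) (f i) q)) X =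
        ∑ i, (f i q * diff (n := n) (ρ i) q X + (ρ i q - h q) * diff (n := n) (f i) q X) := by
      have h2 : (∑ i, diff (n := n) (f i) q X) = 0 := by
        have := congrArg (fun l => l X) hdsum
        simpa using this
      simp only [_root_.sum_apply, _root_.add_apply,
        _root_.smul_apply, smul_eq_mul, sub_mul, Finset.sum_add_distrib,
        Finset.sum_sub_distrib, ← Finset.mul_sum, h2, mul_zero, sub_zero]
    rw [hX]
    calc ‖∑ i, (f i q * diff (n := n) (ρ i) q X + (ρ i q - h q) * diff (n := n) (f i) q X)‖
        ≤ ∑ i, ‖f i q * diff (n := n) (ρ i) q X + (ρ i q - h q) * diff (n := n) (f i) q X‖ :=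
          norm_sum_le _ _
      _ ≤ ∑ i, (f i q * (4 * ‖X‖) + C i * ε * ‖X‖) := by
          refine Finset.sum_le_sum fun i _ => (norm_add_le _ _).trans ?_
          rw [norm_mul, norm_mul, Real.norm_of_nonneg (f.nonneg i q)]
          by_cases hi : q ∈ tsupport (f i)
          · obtain ⟨h3, h4⟩ := hρ i q (hU i hi)
            have h5 := hC i q hqK
            have h6 : ‖diff (n := n) (ρ i) q X‖ ≤ 4 * ‖X‖ :=
              ContinuousLinearMap.le_of_opNorm_le _ h4 X
            have h7 : ‖diff (n := n) (f i) q X‖ ≤ C i * ‖X‖ :=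
              ContinuousLinearMap.le_of_opNorm_le _ h5 X
            have h8 : ‖ρ i q - h q‖ * ‖diff (n := n) (f i) q X‖ ≤ ε * (C i * ‖X‖) :=
              mul_le_mul h3 h7 (norm_nonneg _) hε0.le
            have h9 := mul_le_mul_of_nonneg_left h6 (f.nonneg i q)
            linarith
          · have h3 : f i =ᶠ[𝓝 q] fun _ => (0 : ℝ) := notMem_tsupport_iff_eventuallyEq.1 hi
            rw [diff_congr h3, diff_zero, h3.eq_of_nhds]
            simp only [_root_.zero_apply, norm_zero, mul_zero, zero_mul, zero_add]
            positivity
      _ = (1 * 4 + ∑ i, C i * ε) * ‖X‖ := by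
          rw [Finset.sum_add_distrib, ← Finset.sum_mul, ← Finset.sum_mul, hsum q hqK]; ring
      _ ≤ 5 * ‖X‖ := by gcongr; linarith

end SmoothApproximation

/-! ### Cutoff functions on the line. -/

section Cutoff

theorem exists_deriv_smoothTransition_bound : ∃ C : ℝ, 0 ≤ C ∧
    ∀ x, |deriv Real.smoothTransition x| ≤ C ∧
      (x ∉ Icc (0 : ℝ) 1 → deriv Real.smoothTransition x = 0) := by
  have hc : Continuous (deriv Real.smoothTransition) :=
    (Real.smoothTransition.contDiff (n := 1)).continuous_deriv le_rfl
  obtain ⟨C, hC⟩ := isCompact_Icc.exists_bound_of_continuousOn (s := Icc (0 : ℝ) 1) hc.continuousOn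
  have hout : ∀ x, x ∉ Icc (0 : ℝ) 1 → deriv Real.smoothTransition x = 0 := by
    intro x hx
    rw [mem_Icc, not_and_or, not_le, not_le] at hx
    rcases hx with hx | hx
    · have : Real.smoothTransition =ᶠ[𝓝 x] fun _ => 0 := by
        filter_upwards [Iio_mem_nhds hx] with y hy
        exact Real.smoothTransition.zero_of_nonpos (le_of_lt hy)
      rw [this.deriv_eq]; simp
    · have : Real.smoothTransition =ᶠ[𝓝 x] fun _ => 1 := by
        filter_upwards [Ioi_mem_nhds hx] with y hy
        exact Real.smoothTransition.one_of_one_le (le_of_lt hy)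
      rw [this.deriv_eq]; simp
  refine ⟨max C 0, le_max_right _ _, fun x => ⟨?_, hout x⟩⟩
  by_cases hx : x ∈ Icc (0 : ℝ) 1
  · exact (hC x hx).trans (le_max_left _ _)
  · rw [hout x hx]; simp

/-- A one-dimensional cutoff, vanishing outside `[a, 2R]`, equal to `1` on `[a + 1, R]`. -/
def cutoff (a R : ℝ) (s : ℝ) : ℝ :=
  Real.smoothTransition (s - a) * Real.smoothTransition (2 - s / R)

/-- The inner factor has slope O(1), only on [a, a + 1], and the outer one slope O(1/R), only up to
2R; then (A + B)² ≤ 2A² + 2B². The uniformity of `C` in `a` and `R` is essential. -/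
theorem exists_deriv_cutoff_bound : ∃ C : ℝ, 0 ≤ C ∧ ∀ a R s : ℝ, 0 < R →
    (deriv (cutoff a R) s) ^ 2 ≤ C * ((Icc a (a + 1)).indicator 1 s +
      (Iic (2 * R)).indicator 1 s / R ^ 2) := by
  obtain ⟨C, hC0, hC⟩ := exists_deriv_smoothTransition_bound
  refine ⟨2 * C ^ 2, by positivity, fun a R s hR => ?_⟩
  have hd : ∀ x, HasDerivAt Real.smoothTransition (deriv Real.smoothTransition x) x := fun x =>
    ((Real.smoothTransition.contDiff (n := 1)).differentiable one_ne_zero x).hasDerivAt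
  have h1 : HasDerivAt (fun s => Real.smoothTransition (s - a))
      (deriv Real.smoothTransition (s - a)) s := by
    exact (hd (s - a)).comp_sub_const s a
  have h2 : HasDerivAt (fun s => Real.smoothTransition (2 - s / R))
      (deriv Real.smoothTransition (2 - s / R) * (-(1 / R))) s :=
    HasDerivAt.comp (h := fun s => 2 - s / R) s (hd (2 - s / R))
      (((hasDerivAt_id s).div_const R).const_sub 2)
  have h3 := (h1.mul h2).deriv
  have h4 : deriv (cutoff a R) s = deriv Real.smoothTransition (s - a) *
      Real.smoothTransition (2 - s / R) + Real.smoothTransition (s - a) *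
      (deriv Real.smoothTransition (2 - s / R) * (-(1 / R))) := h3
  rw [h4]
  set A := deriv Real.smoothTransition (s - a) * Real.smoothTransition (2 - s / R) with hA
  set B := Real.smoothTransition (s - a) *
      (deriv Real.smoothTransition (2 - s / R) * (-(1 / R))) with hB
  have hσ : ∀ x, Real.smoothTransition x ^ 2 ≤ 1 := fun x =>
    pow_le_one₀ (Real.smoothTransition.nonneg x) (Real.smoothTransition.le_one x)
  have hCsq : ∀ x, deriv Real.smoothTransition x ^ 2 ≤ C ^ 2 := fun x =>
    sq_le_sq' (abs_le.1 (hC x).1).1 (abs_le.1 (hC x).1).2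
  have hA2 : A ^ 2 ≤ C ^ 2 * (Icc a (a + 1)).indicator 1 s := by
    by_cases hs : s ∈ Icc a (a + 1)
    · rw [indicator_of_mem hs, hA, mul_pow]
      exact mul_le_mul (hCsq _) (hσ _) (sq_nonneg _) (sq_nonneg _)
    · rw [hA, (hC (s - a)).2 (fun h => hs ⟨by linarith [h.1], by linarith [h.2]⟩)]
      simp [hs]
  have hB2 : B ^ 2 ≤ C ^ 2 * ((Iic (2 * R)).indicator 1 s / R ^ 2) := by
    by_cases hs : s ∈ Iic (2 * R)
    · rw [indicator_of_mem hs, hB, mul_pow, mul_pow]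
      have h5 : (-(1 / R)) ^ 2 = 1 / R ^ 2 := by field_simp
      rw [h5, Pi.one_apply]
      have h6 := mul_le_mul_of_nonneg_right (hCsq (2 - s / R)) (by positivity : 0 ≤ 1 / R ^ 2)
      calc _ ≤ 1 * (deriv Real.smoothTransition (2 - s / R) ^ 2 * (1 / R ^ 2)) := by
            gcongr; exact hσ _
        _ ≤ _ := by rw [one_mul]; exact h6
    · have h5 : 2 - s / R ∉ Icc (0 : ℝ) 1 := by
        intro h
        apply hs
        have := h.1
        rw [sub_nonneg, div_le_iff₀ hR] at this
        exact this
      rw [hB, (hC _).2 h5]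
      simp [hs]
  nlinarith [sq_nonneg (A - B)]

end Cutoff

/-! ### Cutoff functions on M. -/

section ManifoldCutoff

theorem contDiff_cutoff (a R : ℝ) : ContDiff ℝ ∞ (cutoff a R) := by
  unfold cutoff
  exact (Real.smoothTransition.contDiff.comp (contDiff_id.sub contDiff_const)).mul
    (Real.smoothTransition.contDiff.comp (contDiff_const.sub (contDiff_id.div_const R)))

theorem cutoff_of_le {a R s : ℝ} (h : s ≤ a) : cutoff a R s = 0 := by
  rw [cutoff, Real.smoothTransition.zero_of_nonpos (by linarith), zero_mul]

theorem cutoff_of_ge {a R s : ℝ} (hR : 0 < R) (h : 2 * R ≤ s) : cutoff a R s = 0 := by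
  rw [cutoff, Real.smoothTransition.zero_of_nonpos (x := 2 - s / R), mul_zero]
  rw [sub_nonpos, le_div_iff₀ hR]
  exact h

theorem cutoff_eq_one {a R s : ℝ} (hR : 0 < R) (h1 : a + 1 ≤ s) (h2 : s ≤ R) :
    cutoff a R s = 1 := by
  have : s / R ≤ 1 := (div_le_one hR).2 h2
  rw [cutoff, Real.smoothTransition.one_of_one_le (by linarith),
    Real.smoothTransition.one_of_one_le (by linarith), one_mul]

variable {n : ℕ} {M : Type*} [MetricSpace M]
    [ChartedSpace (EuclideanSpace ℝ (Fin n)) M] [IsManifold (𝓡 n) ∞ M]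
    [RiemannianBundle (fun p : M => TangentSpace (𝓡 n) p)]
    [IsContMDiffRiemannianBundle (𝓡 n) ∞ (EuclideanSpace ℝ (Fin n))
      (fun p : M => TangentSpace (𝓡 n) p)]
    [IsRiemannianManifold (𝓡 n) M]

/-- Smooth cutoff functions adapted to an annulus `R₀ + 4 ≤ d(·, o) ≤ R - 1`, with a constant `D`
independent of the annulus. -/
theorem exists_manifold_cutoff [ProperSpace M] : ∃ D : ℝ, 0 ≤ D ∧ ∀ (o : M) (R₀ R : ℝ), 0 < R →
    ∃ f : M → ℝ, ContMDiff (𝓡 n) 𝓘(ℝ, ℝ) ∞ f ∧ HasCompactSupport f ∧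
      tsupport f ⊆ (Metric.closedBall o R₀)ᶜ ∧
      (∀ q, R₀ + 4 ≤ dist q o → dist q o ≤ R - 1 → f q = 1) ∧
      ∀ q, ‖diff (n := n) f q‖ ^ 2 ≤ D * ((Metric.closedBall o (R₀ + 4)).indicator 1 q +
        (Metric.closedBall o (2 * R + 1)).indicator 1 q / R ^ 2) := by
  obtain ⟨C, hC0, hC⟩ := exists_deriv_cutoff_bound
  refine ⟨25 * C, by positivity, fun o R₀ R hR => ?_⟩
  obtain ⟨g, hgs, hg⟩ := exists_smooth_approx (n := n) (LipschitzWith.dist_left o)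
    (isCompact_closedBall o (2 * R + 4))
  have hint : ∀ q, dist q o < 2 * R + 4 → |g q - dist q o| ≤ 1 ∧ ‖diff (n := n) g q‖ ≤ 5 := by
    intro q hq
    exact hg q (Metric.ball_subset_interior_closedBall (Metric.mem_ball.2 hq))
  -- Since `g` is within 1 of the distance, ψ ∘ g vanishes up to distance R₀ + 1, leaving room
  -- around the ball of radius `R₀`, and its inner transition ends before distance R₀ + 4.
  set ψ := cutoff (R₀ + 2) R with hψ
  -- `g` is controlled only at distance below 2R + 4. As ψ ∘ g already vanishes between 2R + 1 and
  -- 2R + 3, extending it by 0 is smooth.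
  let f : M → ℝ := fun q => if dist q o < 2 * R + 3 then ψ (g q) else 0
  have hf0 : ∀ q, 2 * R + 1 < dist q o → f q = 0 := by
    intro q hq
    simp only [f]
    split_ifs with h
    · have := abs_le.1 (hint q (by linarith)).1
      exact cutoff_of_ge hR (by linarith [this.1])
    · rfl
  have hf1 : ∀ q, dist q o < R₀ + 1 → f q = 0 := by
    intro q hq
    simp only [f]
    split_ifs with h
    · have := abs_le.1 (hint q (by linarith)).1
      exact cutoff_of_le (by linarith [this.2])
    · rfl
  have hin : ∀ q, dist q o < 2 * R + 3 → f =ᶠ[𝓝 q] ψ ∘ g := by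
    intro q hq
    filter_upwards [Metric.isOpen_ball.mem_nhds (Metric.mem_ball.2 hq)] with z hz
    simp only [f, if_pos (Metric.mem_ball.1 hz), Function.comp_apply]
  have hout : ∀ q, 2 * R + 1 < dist q o → f =ᶠ[𝓝 q] fun _ => 0 := by
    intro q hq
    filter_upwards [(isOpen_lt continuous_const (continuous_id.dist continuous_const)).mem_nhds hq]
      with z hz
    exact hf0 z hz
  have hψs : ContDiff ℝ ∞ ψ := contDiff_cutoff _ _
  have hsupp : Function.support f ⊆ Metric.closedBall o (2 * R + 1) := by
    intro q hq
    by_contra h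
    exact hq (hf0 q (not_le.1 h))
  refine ⟨f, ?_, ?_, ?_, ?_, ?_⟩
  · intro q
    by_cases hq : dist q o < 2 * R + 3
    · exact (hψs.contMDiff.comp hgs).contMDiffAt.congr_of_eventuallyEq (hin q hq)
    · exact contMDiffAt_const.congr_of_eventuallyEq (hout q (by linarith))
  · exact HasCompactSupport.of_support_subset_isCompact (isCompact_closedBall o (2 * R + 1)) hsupp
  · have h1 : Function.support f ⊆ {q | R₀ + 1 ≤ dist q o} := by
      intro q hq
      by_contra h
      exact hq (hf1 q (not_le.1 h))
    have h2 : IsClosed {q : M | R₀ + 1 ≤ dist q o} :=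
      isClosed_le continuous_const (continuous_id.dist continuous_const)
    intro q hq hq'
    have h3 : R₀ + 1 ≤ dist q o := closure_minimal h1 h2 hq
    linarith [Metric.mem_closedBall.1 hq']
  · intro q hq1 hq2
    have h := abs_le.1 (hint q (by linarith)).1
    simp only [f]
    rw [if_pos (by linarith)]
    exact cutoff_eq_one hR (by linarith [h.1]) (by linarith [h.2])
  · intro q
    by_cases hq : dist q o < 2 * R + 3
    · obtain ⟨h1, h2⟩ := hint q (by linarith)
      have h1 := abs_le.1 h1
      have hle : ‖diff (n := n) f q‖ ≤ |deriv ψ (g q)| * 5 := by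
        rw [diff_congr (hin q hq), diff_comp (hψs.differentiable (by simp) _)
          (hgs.mdifferentiableAt (by simp))]
        refine (ContinuousLinearMap.opNorm_comp_le _ _).trans ?_
        rw [← norm_deriv_eq_norm_fderiv, Real.norm_eq_abs]
        gcongr
      have hsq : ‖diff (n := n) f q‖ ^ 2 ≤ 25 * (deriv ψ (g q)) ^ 2 := by
        calc ‖diff (n := n) f q‖ ^ 2 ≤ (|deriv ψ (g q)| * 5) ^ 2 :=
              pow_le_pow_left₀ (ContinuousLinearMap.opNorm_nonneg _) hle 2
          _ = 25 * (deriv ψ (g q)) ^ 2 := by rw [mul_pow, sq_abs]; ring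
      refine hsq.trans ?_
      rw [mul_assoc]
      refine mul_le_mul_of_nonneg_left ((hC _ _ _ hR).trans ?_) (by norm_num)
      refine mul_le_mul_of_nonneg_left ?_ hC0
      have hi : ∀ {A : Set ℝ} {B : Set M}, (g q ∈ A → q ∈ B) →
          A.indicator (1 : ℝ → ℝ) (g q) ≤ B.indicator (1 : M → ℝ) q := by
        intro A B hAB
        by_cases hA : g q ∈ A
        · rw [indicator_of_mem hA, indicator_of_mem (hAB hA)]; rfl
        · rw [indicator_of_notMem hA]
          exact indicator_nonneg (fun _ _ => zero_le_one) _
      refine add_le_add (hi fun h => ?_) (div_le_div_of_nonneg_right (hi fun h => ?_) (sq_nonneg R))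
      · rw [Metric.mem_closedBall]
        linarith [h.2, h1.1]
      · rw [Metric.mem_closedBall]
        linarith [mem_Iic.1 h, h1.1]
    · have h0 : diff (n := n) f q = 0 := by
        rw [diff_congr (hout q (by linarith)), diff_zero]
      have h1 : ‖diff (n := n) f q‖ ^ 2 = 0 := by
        rw [h0, ContinuousLinearMap.opNorm_zero]; norm_num
      rw [h1]
      have h2 : ∀ B : Set M, 0 ≤ B.indicator (1 : M → ℝ) q := fun B =>
        indicator_nonneg (fun _ _ => zero_le_one) _
      have h3 := h2 (Metric.closedBall o (R₀ + 4))
      have h4 := h2 (Metric.closedBall o (2 * R + 1))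
      positivity

end ManifoldCutoff

/-! ### Symmetry of A and continuity of S_r. -/

section ShapeOperator

theorem continuous_charpoly_coeff {ι : Type*} [Fintype ι] [DecidableEq ι] (k : ℕ) :
    Continuous fun A : Matrix ι ι ℝ => A.charpoly.coeff k := by
  have h : (fun A : Matrix ι ι ℝ => A.charpoly.coeff k) = fun A : Matrix ι ι ℝ =>
      MvPolynomial.eval (fun i : ι × ι => A i.1 i.2) ((Matrix.charpoly.univ ℝ ι).coeff k) := by
    ext A
    exact (Matrix.charpoly.univ_coeff_eval₂Hom ι (RingHom.id ℝ) (fun i : ι × ι => A i.1 i.2) k).symm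
  rw [h]
  exact (MvPolynomial.continuous_eval _).comp
    (continuous_pi fun i => (continuous_apply_apply i.1 i.2))

variable {n : ℕ} {c : ℝ} {M : Type*} [MetricSpace M]
  [ChartedSpace (EuclideanSpace ℝ (Fin n)) M] [IsManifold (𝓡 n) ∞ M]

theorem bijective_diff_extChartAt {p q : M}
    (hq : q ∈ (chartAt (EuclideanSpace ℝ (Fin n)) p).source) :
    Function.Bijective (diff (n := n) (extChartAt (𝓡 n) p) q) := by
  have hq' : q ∈ (trivializationAt (EuclideanSpace ℝ (Fin n)) (TangentSpace (𝓡 n)) p).baseSet := by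
    simpa using hq
  have h := Trivialization.coe_continuousLinearEquivAt_eq (R := ℝ)
    (trivializationAt (EuclideanSpace ℝ (Fin n)) (TangentSpace (𝓡 n)) p) hq'
  rw [TangentBundle.continuousLinearMapAt_trivializationAt hq] at h
  have h2 := (Trivialization.continuousLinearEquivAt ℝ
    (trivializationAt (EuclideanSpace ℝ (Fin n)) (TangentSpace (𝓡 n)) p) q hq').bijective
  rw [h] at h2
  exact h2

/-- The differential of the chart at `p`, as an isomorphism `T_qM ≃ ℝⁿ`. -/
def chartDifferential {p q : M} (hq : q ∈ (chartAt (EuclideanSpace ℝ (Fin n)) p).source) :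
    TangentSpace (𝓡 n) q ≃ₗ[ℝ] EuclideanSpace ℝ (Fin n) :=
  LinearEquiv.ofBijective (diff (n := n) (extChartAt (𝓡 n) p) q).toLinearMap
    (bijective_diff_extChartAt hq)

theorem differential_eq_fderiv {F : M → Ambient n} (hF : ContMDiff (𝓡 n) 𝓘(ℝ, Ambient n) ∞ F)
    {p q : M} (hq : q ∈ (chartAt (EuclideanSpace ℝ (Fin n)) p).source)
    (X : TangentSpace (𝓡 n) q) :
    differential F q X = fderiv ℝ (F ∘ (extChartAt (𝓡 n) p).symm) (extChartAt (𝓡 n) p q)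
      (chartDifferential hq X) :=
  congrArg (fun l => l X) (diff_eq_fderiv_comp_extChartAt hF hq)

variable [RiemannianBundle (fun p : M => TangentSpace (𝓡 n) p)]

namespace OrientedHypersurface

variable (x : OrientedHypersurface n c M)

theorem inner_shapeOperator (p : M) (X Y : TangentSpace (𝓡 n) p) :
    inner ℝ (x.shapeOperator p X) Y =
      -ambientForm n c (differential x.normal p X) (differential x.immersion p Y) := by
  change inner ℝ ((InnerProductSpace.toDual ℝ (TangentSpace (𝓡 n) p)).symm
    (-(ambientForm n c (differential x.normal p X)).comp (differential x.immersion p))) Y = _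
  rw [InnerProductSpace.toDual_symm_apply]
  rfl

/-- Differentiating ⟨N, dF(v)⟩ = 0 in a chart gives -⟨dN(w), dF(v)⟩ = ⟨N, D²F(w, v)⟩, and second
derivatives are symmetric. -/
theorem isSymmetric_shapeOperator (p : M) : (x.shapeOperator p).IsSymmetric := by
  set e := extChartAt (𝓡 n) p with he
  set F := x.immersion ∘ e.symm with hF
  set N := x.normal ∘ e.symm with hN
  have hFs : ∀ y ∈ e.target, ContDiffAt ℝ ∞ F y := fun y hy =>
    contDiffAt_comp_extChartAt_symm x.immersion_smooth p hy
  have hNs : ∀ y ∈ e.target, ContDiffAt ℝ ∞ N y := fun y hy =>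
    contDiffAt_comp_extChartAt_symm x.normal_smooth p hy
  have horth : ∀ y ∈ e.target, ∀ v, ambientForm n c (N y) (fderiv ℝ F y v) = 0 := by
    intro y hy v
    have hq : e.symm y ∈ (chartAt (EuclideanSpace ℝ (Fin n)) p).source := by
      have := e.map_target hy
      rwa [he, extChartAt_source] at this
    have h := x.normal_orthogonal (e.symm y) ((chartDifferential hq).symm v)
    rw [differential_eq_fderiv x.immersion_smooth hq, LinearEquiv.apply_symm_apply, ← he,
      e.right_inv hy] at h
    exact h
  have hp : e p ∈ e.target := mem_extChartAt_target p
  have hsymm : IsSymmSndFDerivAt ℝ F (e p) := (hFs _ hp).isSymmSndFDerivAt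
    (by rw [minSmoothness_of_isRCLikeNormedField]; exact ENat.LEInfty.out)
  have hkey : ∀ v w, ambientForm n c (fderiv ℝ N (e p) w) (fderiv ℝ F (e p) v) =
      -ambientForm n c (N (e p)) (fderiv ℝ (fderiv ℝ F) (e p) w v) := by
    intro v w
    have h1 : HasFDerivAt N (fderiv ℝ N (e p)) (e p) :=
      ((hNs _ hp).differentiableAt (by simp)).hasFDerivAt
    have h2 : HasFDerivAt (fderiv ℝ F) (fderiv ℝ (fderiv ℝ F) (e p)) (e p) :=
      (((hFs _ hp).fderiv_right (m := 1)
        (by rw [one_add_one_eq_two]; exact ENat.LEInfty.out)).differentiableAt (by simp)).hasFDerivAt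
    have h3 := (ambientForm n c).hasFDerivAt_of_bilinear h1 (h2.clm_apply (hasFDerivAt_const v _))
    have h4 : (fun y => ambientForm n c (N y) (fderiv ℝ F y v)) =ᶠ[𝓝 (e p)] fun _ => 0 := by
      filter_upwards [extChartAt_target_mem_nhds (I := 𝓡 n) p] with y hy
      exact horth y hy v
    have h5 := congrArg (fun l => l w)
      (h3.unique ((hasFDerivAt_const (0 : ℝ) (e p)).congr_of_eventuallyEq h4))
    simp at h5
    linarith
  have hps : p ∈ (chartAt (EuclideanSpace ℝ (Fin n)) p).source := mem_chart_source _ p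
  have hsff : ∀ X Y : TangentSpace (𝓡 n) p, inner ℝ (x.shapeOperator p X) Y =
      ambientForm n c (N (e p)) (fderiv ℝ (fderiv ℝ F) (e p) (chartDifferential hps X)
        (chartDifferential hps Y)) := by
    intro X Y
    rw [inner_shapeOperator, differential_eq_fderiv x.immersion_smooth hps,
      differential_eq_fderiv x.normal_smooth hps, ← he, hkey, neg_neg]
  intro X Y
  rw [hsff X Y, hsymm.eq, ← hsff Y X, real_inner_comm]

theorem finrank_tangentSpace (p : M) : Module.finrank ℝ (TangentSpace (𝓡 n) p) = n :=
  finrank_euclideanSpace_fin (𝕜 := ℝ) (n := n)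

/-- Vieta's formula; the characteristic polynomial splits because A is symmetric. Coefficients,
unlike individual roots, are visibly continuous. -/
theorem S_eq_coeff {r : ℕ} (hr : r ≤ n) (p : M) :
    x.S r p = (-1) ^ r * (x.shapeOperator p).charpoly.coeff (n - r) := by
  have hdeg : (x.shapeOperator p).charpoly.natDegree = n := by
    rw [LinearMap.charpoly_natDegree, finrank_tangentSpace]
  have h := Polynomial.coeff_eq_esymm_roots_of_splits (x.isSymmetric_shapeOperator p).splits_charpoly
    (k := n - r) (by omega)
  rw [hdeg, (LinearMap.charpoly_monic _).leadingCoeff, one_mul, Nat.sub_sub_self hr] at h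
  rw [h, ← mul_assoc, ← mul_pow]
  simp [S]

theorem S_eq_zero {r : ℕ} (hr : n < r) (p : M) : x.S r p = 0 := by
  have hcard : Multiset.card (x.shapeOperator p).charpoly.roots ≤ n := by
    refine (Polynomial.card_roots' _).trans ?_
    rw [LinearMap.charpoly_natDegree, finrank_tangentSpace]
  rw [S, Multiset.esymm, Multiset.powersetCard_eq_empty _ (hcard.trans_lt hr)]
  simp

/-- The first fundamental form in a chart. -/
def gramMatrix (p : M) (y : EuclideanSpace ℝ (Fin n)) : Matrix (Fin n) (Fin n) ℝ :=
  Matrix.of fun i j => ambientForm n c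
    (fderiv ℝ (x.immersion ∘ (extChartAt (𝓡 n) p).symm) y (EuclideanSpace.basisFun (Fin n) ℝ i))
    (fderiv ℝ (x.immersion ∘ (extChartAt (𝓡 n) p).symm) y (EuclideanSpace.basisFun (Fin n) ℝ j))

/-- The second fundamental form in a chart. -/
def secondFormMatrix (p : M) (y : EuclideanSpace ℝ (Fin n)) : Matrix (Fin n) (Fin n) ℝ :=
  Matrix.of fun i j => -ambientForm n c
    (fderiv ℝ (x.normal ∘ (extChartAt (𝓡 n) p).symm) y (EuclideanSpace.basisFun (Fin n) ℝ i))
    (fderiv ℝ (x.immersion ∘ (extChartAt (𝓡 n) p).symm) y (EuclideanSpace.basisFun (Fin n) ℝ j))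

/-- A kernel vector would give a tangent vector of zero length, by isometry of the immersion. -/
theorem gramMatrix_det_ne_zero {p q : M}
    (hq : q ∈ (chartAt (EuclideanSpace ℝ (Fin n)) p).source) :
    (x.gramMatrix p (extChartAt (𝓡 n) p q)).det ≠ 0 := by
  intro h
  obtain ⟨v, hv, hv0⟩ := Matrix.exists_mulVec_eq_zero_iff.2 h
  let X : TangentSpace (𝓡 n) q :=
    (chartDifferential hq).symm (∑ i, v i • EuclideanSpace.basisFun (Fin n) ℝ i)
  have hX : inner ℝ X X = v ⬝ᵥ (x.gramMatrix p (extChartAt (𝓡 n) p q)).mulVec v := by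
    rw [← x.isometric, differential_eq_fderiv x.immersion_smooth hq]
    simp only [X, LinearEquiv.apply_symm_apply, map_sum, map_smul, dotProduct, Matrix.mulVec,
      gramMatrix, Matrix.of_apply, _root_.sum_apply, _root_.smul_apply, smul_eq_mul, Finset.mul_sum]
    rw [Finset.sum_comm]
    exact Finset.sum_congr rfl fun i _ => Finset.sum_congr rfl fun j _ => by ring
  rw [hv0, dotProduct_zero, inner_self_eq_zero] at hX
  have hsum : ∑ i, v i • EuclideanSpace.basisFun (Fin n) ℝ i = 0 := by
    exact (LinearEquiv.map_eq_zero_iff _).1 hX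
  apply hv
  ext i
  have := congrArg (fun w : EuclideanSpace ℝ (Fin n) => w i) hsum
  simpa [Pi.single_apply] using this

/-- The Weingarten equations say AᵀG = B in the coordinate frame, so Aᵀ = BG⁻¹, and transposition
preserves the characteristic polynomial. -/
theorem charpoly_shapeOperator {p q : M}
    (hq : q ∈ (chartAt (EuclideanSpace ℝ (Fin n)) p).source) :
    (x.shapeOperator q).charpoly = (x.secondFormMatrix p (extChartAt (𝓡 n) p q) *
      (x.gramMatrix p (extChartAt (𝓡 n) p q))⁻¹).charpoly := by
  let b : Module.Basis (Fin n) ℝ (TangentSpace (𝓡 n) q) :=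
    (EuclideanSpace.basisFun (Fin n) ℝ).toBasis.map (chartDifferential hq).symm
  have hb : ∀ i, chartDifferential hq (b i) = EuclideanSpace.basisFun (Fin n) ℝ i := fun i => by
    simp [b]
  set A := LinearMap.toMatrix b b (x.shapeOperator q) with hA
  set G := x.gramMatrix p (extChartAt (𝓡 n) p q) with hG
  have hmul : A.transpose * G = x.secondFormMatrix p (extChartAt (𝓡 n) p q) := by
    ext i j
    have h1 : x.shapeOperator q (b i) = ∑ k, A k i • b k := by
      rw [← b.sum_repr (x.shapeOperator q (b i))]
      simp [hA, LinearMap.toMatrix_apply]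
    have h2 := x.inner_shapeOperator q (b i) (b j)
    rw [h1, ← x.isometric, differential_eq_fderiv x.immersion_smooth hq,
      differential_eq_fderiv x.immersion_smooth hq, differential_eq_fderiv x.normal_smooth hq] at h2
    simp only [map_sum, map_smul, hb, _root_.sum_apply, _root_.smul_apply, smul_eq_mul] at h2
    simp only [Matrix.mul_apply, Matrix.transpose_apply, hG, gramMatrix, secondFormMatrix,
      Matrix.of_apply]
    exact h2
  have hG0 : IsUnit G.det := isUnit_iff_ne_zero.2 (x.gramMatrix_det_ne_zero hq)
  rw [← LinearMap.charpoly_toMatrix _ b, ← hA, ← Matrix.charpoly_transpose, ← hmul,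
    Matrix.mul_nonsing_inv_cancel_right _ _ hG0]

theorem continuous_S (r : ℕ) : Continuous (x.S r) := by
  rcases lt_or_ge n r with hr | hr
  · have : x.S r = fun _ => 0 := funext fun p => x.S_eq_zero hr p
    rw [this]; exact continuous_const
  rw [continuous_iff_continuousAt]
  intro p
  set e := extChartAt (𝓡 n) p with he
  have hFs := (contDiffAt_comp_extChartAt_symm x.immersion_smooth p (mem_extChartAt_target p)
    |>.fderiv_right (m := 0) (by simp)).continuousAt
  have hNs := (contDiffAt_comp_extChartAt_symm x.normal_smooth p (mem_extChartAt_target p)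
    |>.fderiv_right (m := 0) (by simp)).continuousAt
  have hG : ContinuousAt (x.gramMatrix p) (e p) := by
    refine continuousAt_pi.2 fun i => continuousAt_pi.2 fun j => ?_
    exact ((ambientForm n c).continuous.continuousAt.comp (hFs.clm_apply continuousAt_const)).clm_apply
      (hFs.clm_apply continuousAt_const)
  have hB : ContinuousAt (x.secondFormMatrix p) (e p) := by
    refine continuousAt_pi.2 fun i => continuousAt_pi.2 fun j => ContinuousAt.neg ?_
    exact ((ambientForm n c).continuous.continuousAt.comp (hNs.clm_apply continuousAt_const)).clm_apply
      (hFs.clm_apply continuousAt_const)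
  have hinv : ContinuousAt (fun y => (x.gramMatrix p y)⁻¹) (e p) := by
    apply ContinuousAt.comp (g := Inv.inv) _ hG
    apply continuousAt_matrix_inv
    rw [Ring.inverse_eq_inv']
    exact continuousAt_inv₀ (x.gramMatrix_det_ne_zero (mem_chart_source _ p))
  have hc : ContinuousAt (fun q => (-1) ^ r *
      (x.secondFormMatrix p (e q) * (x.gramMatrix p (e q))⁻¹).charpoly.coeff (n - r)) p := by
    refine ContinuousAt.mul continuousAt_const ?_
    have h1 : ContinuousAt (fun y => x.secondFormMatrix p y * (x.gramMatrix p y)⁻¹) (e p) :=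
      hB.mul hinv
    exact (continuous_charpoly_coeff (n - r)).continuousAt.comp
      (ContinuousAt.comp (g := fun y => x.secondFormMatrix p y * (x.gramMatrix p y)⁻¹) h1
        (continuousAt_extChartAt (I := 𝓡 n) p))
  refine hc.congr ?_
  filter_upwards [(chartAt (EuclideanSpace ℝ (Fin n)) p).open_source.mem_nhds (mem_chart_source _ p)]
    with q hq
  rw [x.S_eq_coeff hr, x.charpoly_shapeOperator hq]

end OrientedHypersurface

end ShapeOperator

/-! ### Pointwise bounds for the potential and for P₁. -/

section PointwiseEstimates

variable {n : ℕ} {c : ℝ} {M : Type*} [MetricSpace M]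
  [ChartedSpace (EuclideanSpace ℝ (Fin n)) M] [IsManifold (𝓡 n) ∞ M]
  [RiemannianBundle (fun p : M => TangentSpace (𝓡 n) p)]

theorem norm_grad (f : M → ℝ) (p : M) : ‖grad (n := n) f p‖ = ‖diff (n := n) f p‖ :=
  LinearIsometryEquiv.norm_map (InnerProductSpace.toDual ℝ (TangentSpace (𝓡 n) p)).symm _

namespace OrientedHypersurface

variable (x : OrientedHypersurface n c M)

/-- The principal curvatures at `p`. -/
def principalCurvature (p : M) : Fin n → ℝ :=
  (x.isSymmetric_shapeOperator p).eigenvalues (finrank_tangentSpace p)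

theorem S_eq_esymm (r : ℕ) (p : M) :
    x.S r p = (Finset.univ.val.map (x.principalCurvature p)).esymm r := by
  rw [S, (x.isSymmetric_shapeOperator p).roots_charpoly_eq_eigenvalues (finrank_tangentSpace p)]
  rfl

theorem S_one_eq (p : M) : x.S 1 p = ∑ i, x.principalCurvature p i := by
  rw [S_eq_esymm]; exact (newton_identities_le_three _).1

theorem two_mul_S_two_eq (p : M) :
    2 * x.S 2 p = (x.S 1 p) ^ 2 - ∑ i, x.principalCurvature p i ^ 2 := by
  rw [S_one_eq, S_eq_esymm]; exact (newton_identities_le_three _).2.1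

theorem S_one_mul_S_two_sub_eq (p : M) : x.S 1 p * x.S 2 p - 3 * x.S 3 p =
    ∑ i, x.principalCurvature p i ^ 2 * (x.S 1 p - x.principalCurvature p i) := by
  rw [x.S_one_eq p, ← (newton_identities_le_three _).1, S_eq_esymm, S_eq_esymm]
  rw [(newton_identities_le_three _).2.2, (newton_identities_le_three _).1]

theorem two_mul_S_one_mul_S_two_le (hn : 2 ≤ n) {p : M} (h1 : 0 ≤ x.S 1 p) (h2 : 0 ≤ x.S 2 p) :
    2 * (x.S 1 p * x.S 2 p) ≤ n * (x.S 1 p * x.S 2 p - 3 * x.S 3 p) := by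
  have h := sum_mul_sub_le_card_mul_sum (x.principalCurvature p) (by simpa using hn)
    (by rw [← S_one_eq]; exact h1) (by rw [← S_one_eq]; linarith [x.two_mul_S_two_eq p])
  rw [← S_one_eq, ← two_mul_S_two_eq, ← S_one_mul_S_two_sub_eq, Fintype.card_fin] at h
  linarith

/-- Diagonalise A: λ_i² ≤ ∑ λ_j² = S₁² - 2S₂ ≤ S₁². -/
theorem abs_inner_shapeOperator_le {p : M} (h1 : 0 ≤ x.S 1 p) (h2 : 0 ≤ x.S 2 p)
    (X : TangentSpace (𝓡 n) p) : |inner ℝ (x.shapeOperator p X) X| ≤ x.S 1 p * ‖X‖ ^ 2 := by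
  let hT := x.isSymmetric_shapeOperator p
  let b := hT.eigenvectorBasis (finrank_tangentSpace p)
  have hle : ∀ i, |x.principalCurvature p i| ≤ x.S 1 p := fun i => by
    rw [S_one_eq]
    exact abs_le_sum_of_sum_sq_le _ (by rw [← S_one_eq]; exact h1)
      (by rw [← S_one_eq]; linarith [x.two_mul_S_two_eq p]) i
  have hin : inner ℝ (x.shapeOperator p X) X =
      ∑ i, x.principalCurvature p i * (inner ℝ X (b i)) ^ 2 := by
    rw [← b.sum_inner_mul_inner]
    refine Finset.sum_congr rfl fun i _ => ?_
    have h3 : x.shapeOperator p (b i) = x.principalCurvature p i • b i :=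
      hT.apply_eigenvectorBasis (finrank_tangentSpace p) i
    rw [hT X (b i), h3, real_inner_smul_right, real_inner_comm X (b i)]
    ring
  have hX : ‖X‖ ^ 2 = ∑ i, (inner ℝ X (b i)) ^ 2 := by
    rw [← real_inner_self_eq_norm_sq, ← b.sum_inner_mul_inner]
    refine Finset.sum_congr rfl fun i _ => ?_
    rw [real_inner_comm X (b i), sq]
  rw [hin, hX, Finset.mul_sum]
  refine (Finset.abs_sum_le_sum_abs _ _).trans (Finset.sum_le_sum fun i _ => ?_)
  rw [abs_mul, abs_of_nonneg (sq_nonneg (inner ℝ X (b i)))]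
  exact mul_le_mul_of_nonneg_right (hle i) (sq_nonneg _)

theorem inner_P₁ (p : M) (X : TangentSpace (𝓡 n) p) :
    inner ℝ (x.P₁ p X) X = x.S 1 p * ‖X‖ ^ 2 - inner ℝ (x.shapeOperator p X) X := by
  have : x.P₁ p X = x.S 1 p • X - x.shapeOperator p X := rfl
  rw [this, inner_sub_left, real_inner_smul_left, real_inner_self_eq_norm_sq]

theorem inner_P₁_nonneg {p : M} (h1 : 0 ≤ x.S 1 p) (h2 : 0 ≤ x.S 2 p)
    (X : TangentSpace (𝓡 n) p) : 0 ≤ inner ℝ (x.P₁ p X) X := by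
  rw [inner_P₁]
  linarith [(abs_le.1 (x.abs_inner_shapeOperator_le h1 h2 X)).2]

theorem inner_P₁_le {p : M} (h1 : 0 ≤ x.S 1 p) (h2 : 0 ≤ x.S 2 p)
    (X : TangentSpace (𝓡 n) p) : inner ℝ (x.P₁ p X) X ≤ 2 * (x.S 1 p * ‖X‖ ^ 2) := by
  rw [inner_P₁]
  linarith [(abs_le.1 (x.abs_inner_shapeOperator_le h1 h2 X)).1]

end OrientedHypersurface

end PointwiseEstimates

/-! ### From the growth inequality to the limits. -/

section Growth

theorem tendsto_div_sq_of_growth_inequality {V : ℝ → ℝ} {δ E C : ℝ} (hδ : 0 < δ) (hE : 0 < E)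
    (hV : ∀ ρ, 4 ≤ ρ → δ * V (ρ / 2 - 2) ≤ C + E * (1 / ρ ^ 2 * V ρ))
    (hinf : Tendsto V atTop atTop) : Tendsto (fun ρ => 1 / ρ ^ 2 * V ρ) atTop atTop := by
  have h1 : Tendsto (fun ρ : ℝ => ρ / 2 - 2) atTop atTop :=
    tendsto_atTop_add_const_right _ _ (tendsto_id.atTop_div_const zero_lt_two)
  have h2 : Tendsto (fun ρ => (δ * V (ρ / 2 - 2) - C) / E) atTop atTop :=
    (tendsto_atTop_add_const_right _ (-C) ((hinf.comp h1).const_mul_atTop hδ)).atTop_div_const hE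
  refine tendsto_atTop_mono' _ ?_ h2
  filter_upwards [eventually_ge_atTop 4] with ρ hρ
  rw [div_le_iff₀ hE]
  linarith [hV ρ hρ]

/-- For ρ ≥ 6 the left side is at least δV(1) > 0, which forces V to grow at least quadratically. -/
theorem tendsto_of_growth_inequality {V : ℝ → ℝ} {δ E : ℝ} (hδ : 0 < δ) (hE : 0 < E)
    (hV : ∀ ρ, 4 ≤ ρ → δ * V (ρ / 2 - 2) ≤ E * (1 / ρ ^ 2 * V ρ)) (hmono : Monotone V)
    (hpos : 0 < V 1) : Tendsto V atTop atTop := by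
  have h1 : Tendsto (fun ρ : ℝ => δ * V 1 / E * ρ ^ 2) atTop atTop :=
    (tendsto_pow_atTop two_ne_zero).const_mul_atTop (by positivity)
  refine tendsto_atTop_mono' _ ?_ h1
  filter_upwards [eventually_ge_atTop 6] with ρ hρ
  have h2 := hV ρ (by linarith)
  have h3 : V 1 ≤ V (ρ / 2 - 2) := hmono (by linarith)
  have h4 : δ * V 1 ≤ E * (1 / ρ ^ 2 * V ρ) :=
    (mul_le_mul_of_nonneg_left h3 hδ.le).trans h2
  have hρ2 : 0 < ρ ^ 2 := by positivity
  rw [div_mul_eq_mul_div, div_le_iff₀ hE]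
  calc δ * V 1 * ρ ^ 2 ≤ E * (1 / ρ ^ 2 * V ρ) * ρ ^ 2 :=
        mul_le_mul_of_nonneg_right h4 hρ2.le
    _ = V ρ * E := by field_simp

theorem tendsto_setIntegral_ball_of_lintegral_eq_top {X : Type*} [MetricSpace X]
    [MeasurableSpace X] [BorelSpace X] {μ : Measure X} {w : X → ℝ} (hw : ∀ p, 0 ≤ w p)
    (hwm : Measurable w) (hint : ∀ o R, IntegrableOn w (Metric.ball o R) μ)
    (htop : ∫⁻ p, ENNReal.ofReal (w p) ∂μ = ⊤) (o : X) :
    Tendsto (fun R => ∫ p in Metric.ball o R, w p ∂μ) atTop atTop := by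
  have h1 : Tendsto (fun R => ∫⁻ p in Metric.ball o R, ENNReal.ofReal (w p) ∂μ) atTop (𝓝 ⊤) := by
    rw [← htop]
    exact (aecover_ball tendsto_id).lintegral_tendsto_of_countably_generated
      hwm.ennreal_ofReal.aemeasurable
  rw [tendsto_atTop]
  intro b
  filter_upwards [h1.eventually (lt_mem_nhds (ENNReal.ofReal_lt_top (r := b)))] with R hR
  rw [← ofReal_integral_eq_lintegral_ofReal (hint o R) (Eventually.of_forall hw)] at hR
  exact (ENNReal.ofReal_lt_ofReal_iff'.1 hR).1.le

end Growth

/-! ### Stability tested on cutoff functions. -/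

section StabilityEstimate

variable {n : ℕ} {c : ℝ} {M : Type*} [MetricSpace M] [MeasurableSpace M] [BorelSpace M]
  [ChartedSpace (EuclideanSpace ℝ (Fin n)) M] [IsManifold (𝓡 n) ∞ M]
  [RiemannianBundle (fun p : M => TangentSpace (𝓡 n) p)]
  [IsContMDiffRiemannianBundle (𝓡 n) ∞ (EuclideanSpace ℝ (Fin n))
    (fun p : M => TangentSpace (𝓡 n) p)]
  [IsRiemannianManifold (𝓡 n) M]

namespace OrientedHypersurface

variable (x : OrientedHypersurface n c M)

theorem integrableOn_S_of_isCompact (r : ℕ) {K : Set M} (hK : IsCompact K) :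
    IntegrableOn (x.S r) K x.vol := by
  have _ : IsLocallyFiniteMeasure x.vol := isLocallyFiniteMeasure_volume n M
  exact (x.continuous_S r).continuousOn.integrableOn_compact hK

theorem integrableOn_S_ball [ProperSpace M] (r : ℕ) (o : M) (R : ℝ) :
    IntegrableOn (x.S r) (Metric.ball o R) x.vol :=
  (x.integrableOn_S_of_isCompact r (isCompact_closedBall o R)).mono_set Metric.ball_subset_closedBall

/-- The stability inequality tested on a cutoff function. -/
theorem integral_annulus_le [ProperSpace M] {δ : ℝ} (hδ : 0 ≤ δ) (h1 : ∀ p, 0 < x.S 1 p)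
    (h2 : ∀ p, 0 ≤ x.S 2 p)
    (hpot : ∀ p, δ * x.S 1 p ≤
      x.S 1 p * x.S 2 p - 3 * x.S 3 p + c * ((n : ℝ) - 1) * x.S 1 p)
    {U : Set M} (hU : x.StronglyStableOn U) {f : M → ℝ} (hf : ContMDiff (𝓡 n) 𝓘(ℝ, ℝ) ∞ f)
    (hfc : HasCompactSupport f) (hfU : tsupport f ⊆ U) {A B₁ B₂ : Set M} (hA : IsCompact A)
    (hB₁ : IsCompact B₁) (hB₂ : IsCompact B₂) (hfA : ∀ p ∈ A, f p = 1) {D R : ℝ}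
    (hdf : ∀ p, ‖diff (n := n) f p‖ ^ 2 ≤
      D * (B₁.indicator 1 p + B₂.indicator 1 p / R ^ 2)) :
    δ * ∫ p in A, x.S 1 p ∂x.vol ≤
      2 * D * ((∫ p in B₁, x.S 1 p ∂x.vol) + (∫ p in B₂, x.S 1 p ∂x.vol) / R ^ 2) := by
  have _ : IsLocallyFiniteMeasure x.vol := isLocallyFiniteMeasure_volume n M
  have hstab := hU f hf hfc hfU
  have hleft : δ * ∫ p in A, x.S 1 p ∂x.vol ≤
      ∫ p, (x.S 1 p * x.S 2 p - 3 * x.S 3 p + c * ((n : ℝ) - 1) * x.S 1 p) * f p ^ 2 ∂x.vol := by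
    rw [← integral_const_mul, ← integral_indicator hA.measurableSet]
    refine integral_mono ?_ ?_ fun p => ?_
    · have hi : IntegrableOn (fun p => δ * x.S 1 p) A x.vol :=
        (x.integrableOn_S_of_isCompact 1 hA).const_mul δ
      exact hi.integrable_indicator hA.measurableSet
    · have hc : Continuous fun p => x.S 1 p * x.S 2 p - 3 * x.S 3 p +
          c * ((n : ℝ) - 1) * x.S 1 p :=
        (((x.continuous_S 1).mul (x.continuous_S 2)).sub ((x.continuous_S 3).const_mul 3)).add
          ((x.continuous_S 1).const_mul _)
      refine (hc.mul (hf.continuous.pow 2)).integrable_of_hasCompactSupport ?_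
      refine hfc.mono fun p hp h0 => hp ?_
      rw [Pi.mul_apply, Pi.pow_apply, h0, zero_pow two_ne_zero, mul_zero]
    · by_cases hp : p ∈ A
      · rw [indicator_of_mem hp, hfA p hp, one_pow, mul_one]
        exact hpot p
      · rw [indicator_of_notMem hp]
        exact mul_nonneg ((mul_nonneg hδ (h1 p).le).trans (hpot p)) (sq_nonneg _)
  have hint : ∀ {B : Set M}, IsCompact B → Integrable (B.indicator (x.S 1)) x.vol := fun hB =>
    (x.integrableOn_S_of_isCompact 1 hB).integrable_indicator hB.measurableSet
  have hright : ∫ p, inner ℝ (x.P₁ p (grad f p)) (grad f p) ∂x.vol ≤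
      ∫ p, 2 * D * (B₁.indicator (x.S 1) p + B₂.indicator (x.S 1) p / R ^ 2) ∂x.vol := by
    -- Nonnegativity of the integrand and integrability of the majorant suffice, so integrability of
    -- ⟨P₁∇f, ∇f⟩ is not needed.
    refine integral_mono_of_nonneg (Eventually.of_forall fun p =>
      x.inner_P₁_nonneg (h1 p).le (h2 p) _)
      (((hint hB₁).add ((hint hB₂).div_const _)).const_mul _) (Eventually.of_forall fun p => ?_)
    refine (x.inner_P₁_le (h1 p).le (h2 p) _).trans ?_
    rw [norm_grad]
    have h3 := mul_le_mul_of_nonneg_left (hdf p) (h1 p).le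
    have h4 : ∀ B : Set M, B.indicator (x.S 1) p = x.S 1 p * B.indicator 1 p := fun B => by
      by_cases hp : p ∈ B <;> simp [hp]
    beta_reduce
    rw [h4, h4]
    calc 2 * (x.S 1 p * ‖diff (n := n) f p‖ ^ 2)
        ≤ 2 * (x.S 1 p * (D * (B₁.indicator 1 p + B₂.indicator 1 p / R ^ 2))) := by linarith
      _ = _ := by ring
  rw [integral_const_mul, integral_add (hint hB₁) ((hint hB₂).div_const _), integral_div,
    integral_indicator hB₁.measurableSet, integral_indicator hB₂.measurableSet] at hright
  exact hleft.trans (hstab.trans hright)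

/-- Growth inequality for `V(ρ) = ∫_{B_ρ} S₁` if the complement of `B_{R₀}` is strongly stable. -/
theorem exists_growth_inequality [ProperSpace M] {δ : ℝ} (hδ : 0 ≤ δ) (h1 : ∀ p, 0 < x.S 1 p)
    (h2 : ∀ p, 0 ≤ x.S 2 p)
    (hpot : ∀ p, δ * x.S 1 p ≤
      x.S 1 p * x.S 2 p - 3 * x.S 3 p + c * ((n : ℝ) - 1) * x.S 1 p) :
    ∃ E C : ℝ, 0 < E ∧ ∀ (U : Set M) (o : M) (R₀ : ℝ), x.StronglyStableOn U →
      (Metric.closedBall o R₀)ᶜ ⊆ U → ∀ ρ, 4 ≤ ρ →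
      δ * ∫ p in Metric.ball o (ρ / 2 - 2), x.S 1 p ∂x.vol ≤
        C * (∫ p in Metric.closedBall o (R₀ + 4), x.S 1 p ∂x.vol) +
          E * (1 / ρ ^ 2 * ∫ p in Metric.ball o ρ, x.S 1 p ∂x.vol) := by
  obtain ⟨D, hD, hcut⟩ := exists_manifold_cutoff (n := n) (M := M)
  -- 32D = 2D · 16 comes from 1/R² ≤ 16/ρ², with 1 added for positivity. In the other constant, δ
  -- pays for the part of the ball missed by the annulus and 2D for the inner gradient.
  refine ⟨32 * D + 1, δ + 2 * D, by positivity, fun U o R₀ hU hoU ρ hρ => ?_⟩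
  -- Chosen so that 2R + 1 = ρ - 1 < ρ and R - 1 = ρ/2 - 2; ρ ≥ 4 gives R ≥ ρ/4.
  set R := ρ / 2 - 1 with hR
  have hR0 : 0 < R := by linarith
  obtain ⟨f, hf, hfc, hfU, hf1, hdf⟩ := hcut o R₀ R hR0
  set A := Metric.closedBall o (R - 1) ∩ {p | R₀ + 4 ≤ dist p o} with hA
  have hAc : IsCompact A := (isCompact_closedBall o (R - 1)).inter_right
    (isClosed_le continuous_const (continuous_id.dist continuous_const))
  have hmain := x.integral_annulus_le hδ h1 h2 hpot hU hf hfc (hfU.trans hoU) hAc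
    (isCompact_closedBall o (R₀ + 4)) (isCompact_closedBall o (2 * R + 1))
    (fun p hp => hf1 p hp.2 hp.1) hdf
  have hnn : ∀ s : Set M, 0 ≤ᵐ[x.vol.restrict s] x.S 1 := fun s =>
    Eventually.of_forall fun p => (h1 p).le
  have hsplit : ∫ p in Metric.ball o (ρ / 2 - 2), x.S 1 p ∂x.vol ≤
      (∫ p in A, x.S 1 p ∂x.vol) + ∫ p in Metric.closedBall o (R₀ + 4), x.S 1 p ∂x.vol := by
    have hsub : Metric.ball o (ρ / 2 - 2) ⊆ A ∪ (Metric.closedBall o (R₀ + 4) \ A) := by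
      intro p hp
      rw [union_sdiff_self]
      by_cases hp2 : R₀ + 4 ≤ dist p o
      · refine Or.inl ⟨?_, hp2⟩
        rw [Metric.mem_closedBall]
        linarith [Metric.mem_ball.1 hp]
      · exact Or.inr (not_le.1 hp2).le
    have hi1 := x.integrableOn_S_of_isCompact 1 hAc
    have hi2 := x.integrableOn_S_of_isCompact 1 (isCompact_closedBall o (R₀ + 4))
    have hi3 := hi2.mono_set (sdiff_subset (t := A))
    calc ∫ p in Metric.ball o (ρ / 2 - 2), x.S 1 p ∂x.vol
        ≤ ∫ p in A ∪ (Metric.closedBall o (R₀ + 4) \ A), x.S 1 p ∂x.vol :=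
          setIntegral_mono_set (hi1.union hi3) (hnn _) hsub.eventuallyLE
      _ = (∫ p in A, x.S 1 p ∂x.vol) + ∫ p in Metric.closedBall o (R₀ + 4) \ A, x.S 1 p ∂x.vol :=
          setIntegral_union disjoint_sdiff_right
            (Metric.isClosed_closedBall.measurableSet.diff hAc.measurableSet) hi1 hi3
      _ ≤ _ := by
          exact add_le_add le_rfl (setIntegral_mono_set hi2 (hnn _) sdiff_subset.eventuallyLE)
  have hball : ∫ p in Metric.closedBall o (2 * R + 1), x.S 1 p ∂x.vol ≤
      ∫ p in Metric.ball o ρ, x.S 1 p ∂x.vol :=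
    setIntegral_mono_set (x.integrableOn_S_ball 1 o ρ) (hnn _)
      (Metric.closedBall_subset_ball (by linarith)).eventuallyLE
  set W := ∫ p in Metric.closedBall o (R₀ + 4), x.S 1 p ∂x.vol with hW
  set V := ∫ p in Metric.ball o ρ, x.S 1 p ∂x.vol with hV
  have hV0 : 0 ≤ V := integral_nonneg fun p => (h1 p).le
  have hW2 : 0 ≤ ∫ p in Metric.closedBall o (2 * R + 1), x.S 1 p ∂x.vol :=
    integral_nonneg fun p => (h1 p).le
  have hRρ : 1 / R ^ 2 ≤ 16 * (1 / ρ ^ 2) := by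
    have h3 : ρ / 4 ≤ R := by linarith
    have h4 : (ρ / 4) ^ 2 ≤ R ^ 2 := pow_le_pow_left₀ (by linarith) h3 2
    calc 1 / R ^ 2 ≤ 1 / (ρ / 4) ^ 2 := one_div_le_one_div_of_le (by positivity) h4
      _ = 16 * (1 / ρ ^ 2) := by field_simp; norm_num
  have h5 : (∫ p in Metric.closedBall o (2 * R + 1), x.S 1 p ∂x.vol) / R ^ 2 ≤
      16 * (1 / ρ ^ 2 * V) := by
    rw [div_eq_mul_one_div, mul_comm]
    calc _ ≤ (16 * (1 / ρ ^ 2)) * V := mul_le_mul hRρ hball hW2 (by positivity)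
      _ = _ := by ring
  have h6 := mul_le_mul_of_nonneg_left hsplit hδ
  have h7 := mul_le_mul_of_nonneg_left h5 (by positivity : 0 ≤ 2 * D)
  have h8 : 0 ≤ 1 / ρ ^ 2 * V := by positivity
  linarith

end OrientedHypersurface

end StabilityEstimate

end SpaceFormHypersurface

end

/-! ### The main theorem. -/

open SpaceFormHypersurface SpaceFormHypersurface.OrientedHypersurface in
theorem lemma3p2 (n : ℕ) (c : ℝ) (M : Type*) [MetricSpace M] [ConnectedSpace M]
    [MeasurableSpace M] [BorelSpace M]
    [ChartedSpace (EuclideanSpace ℝ (Fin n)) M] [IsManifold (𝓡 n) ∞ M]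
    [RiemannianBundle (fun p : M => TangentSpace (𝓡 n) p)]
    [IsContMDiffRiemannianBundle (𝓡 n) ∞ (EuclideanSpace ℝ (Fin n))
      (fun p : M => TangentSpace (𝓡 n) p)]
    [IsRiemannianManifold (𝓡 n) M] [CompleteSpace M]
    (x : SpaceFormHypersurface.OrientedHypersurface n c M)
    (S₂ : ℝ) (hS₂ : ∀ p, x.S 2 p = S₂) (hS₂_nonneg : 0 ≤ S₂)
    (hS₂_gt : -((n : ℝ) * ((n : ℝ) - 1) / 2) * c < S₂)
    (hS₁ : ∀ p, 0 < x.S 1 p) :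
    ((∃ K : Set M, IsCompact K ∧ x.StronglyStableOn Kᶜ) →
      x.oneVolume < ⊤ ∨
        ∀ o : M, Tendsto (fun R : ℝ => 1 / R ^ 2 * ∫ p in Metric.ball o R, x.S 1 p ∂x.vol)
          atTop atTop) ∧
    (x.StronglyStableOn univ →
      (∀ o : M, Tendsto (fun R : ℝ => 1 / R ^ 2 * ∫ p in Metric.ball o R, x.S 1 p ∂x.vol)
        atTop atTop) ∧
      x.oneVolume = ⊤) := by
  have _ : ProperSpace M := properSpace_of_complete n M
  have _ : x.vol.IsOpenPosMeasure := isOpenPosMeasure_volume n M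
  obtain ⟨p₀⟩ : Nonempty M := inferInstance
  -- For n ≤ 1 both S₂ and n(n-1) vanish, and the strict lower bound on S₂ would read 0 < 0.
  have hn : 2 ≤ n := by
    by_contra h
    have h2 : S₂ = 0 := by rw [← hS₂ p₀]; exact x.S_eq_zero (by omega) p₀
    have h3 : n = 0 ∨ n = 1 := by omega
    rcases h3 with rfl | rfl <;> simp [h2] at hS₂_gt
  have hn0 : (0 : ℝ) < n := by exact_mod_cast (by omega : 0 < n)
  set δ : ℝ := 2 / n * S₂ + c * ((n : ℝ) - 1) with hδdef
  have hδ : 0 < δ := by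
    have : δ = 2 / n * (S₂ + (n : ℝ) * ((n : ℝ) - 1) / 2 * c) := by
      rw [hδdef]; field_simp
    rw [this]
    apply mul_pos (by positivity)
    linarith
  have h2 : ∀ p, 0 ≤ x.S 2 p := fun p => by rw [hS₂]; exact hS₂_nonneg
  have hpot : ∀ p, δ * x.S 1 p ≤
      x.S 1 p * x.S 2 p - 3 * x.S 3 p + c * ((n : ℝ) - 1) * x.S 1 p := by
    intro p
    have h := x.two_mul_S_one_mul_S_two_le hn (hS₁ p).le (h2 p)
    have h3 : 2 / n * (x.S 1 p * x.S 2 p) ≤ x.S 1 p * x.S 2 p - 3 * x.S 3 p := by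
      rw [div_mul_eq_mul_div, div_le_iff₀ hn0]; linarith
    rw [hS₂] at h3 ⊢
    rw [hδdef]
    linarith
  obtain ⟨E, C, hE, hgrowth⟩ := x.exists_growth_inequality hδ.le hS₁ h2 hpot
  have hint := x.integrableOn_S_ball 1
  have htop : x.oneVolume = ⊤ → ∀ o : M,
      Tendsto (fun R : ℝ => ∫ p in Metric.ball o R, x.S 1 p ∂x.vol) atTop atTop := fun h o =>
    tendsto_setIntegral_ball_of_lintegral_eq_top (fun p => (hS₁ p).le)
      (x.continuous_S 1).measurable hint h o
  constructor
  · rintro ⟨K, hK, hstab⟩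
    by_cases hvol : x.oneVolume < ⊤
    · exact Or.inl hvol
    right
    intro o
    obtain ⟨R₀, hR₀⟩ := hK.isBounded.subset_closedBall o
    exact tendsto_div_sq_of_growth_inequality hδ hE
      (fun ρ hρ => hgrowth Kᶜ o R₀ hstab (compl_subset_compl.2 hR₀) ρ hρ)
      (htop (not_lt_top_iff.1 hvol) o)
  · intro hstab
    have hlim : ∀ o : M, Tendsto (fun R : ℝ => 1 / R ^ 2 *
        ∫ p in Metric.ball o R, x.S 1 p ∂x.vol) atTop atTop := by
      intro o
      have hV : ∀ ρ, 4 ≤ ρ → δ * ∫ p in Metric.ball o (ρ / 2 - 2), x.S 1 p ∂x.vol ≤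
          E * (1 / ρ ^ 2 * ∫ p in Metric.ball o ρ, x.S 1 p ∂x.vol) := by
        intro ρ hρ
        -- With R₀ = -5 the ball of radius R₀ + 4 is empty, so the constant term vanishes.
        have h := hgrowth univ o (-5) hstab (subset_univ _) ρ hρ
        rw [Metric.closedBall_eq_empty.2 (by norm_num : (-5 : ℝ) + 4 < 0)] at h
        simpa using h
      have hmono : Monotone fun R : ℝ => ∫ p in Metric.ball o R, x.S 1 p ∂x.vol := fun a b hab =>
        setIntegral_mono_set (hint o b) (Eventually.of_forall fun p => (hS₁ p).le)
          (Metric.ball_subset_ball hab).eventuallyLE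
      have hpos : 0 < ∫ p in Metric.ball o 1, x.S 1 p ∂x.vol := by
        rw [setIntegral_pos_iff_support_of_nonneg_ae (Eventually.of_forall fun p => (hS₁ p).le)
          (hint o 1)]
        have : Function.support (x.S 1) = univ := by
          ext p; simpa using (hS₁ p).ne'
        rw [this, univ_inter]
        exact Metric.measure_ball_pos _ _ one_pos
      -- The growth inequality is used twice: for V → ∞, and then for V(ρ)/ρ² → ∞.
      exact tendsto_div_sq_of_growth_inequality (C := 0) hδ hE
        (fun ρ hρ => by rw [zero_add]; exact hV ρ hρ)
        (tendsto_of_growth_inequality hδ hE hV hmono hpos)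
    refine ⟨hlim, ?_⟩
    by_contra hvol
    -- A finite 1-volume would bound the quotient for R ≥ 1, contradicting the limit.
    have hb : ∀ R, 1 ≤ R → 1 / R ^ 2 * ∫ p in Metric.ball p₀ R, x.S 1 p ∂x.vol ≤
        x.oneVolume.toReal := by
      intro R hR
      have h3 : ∫ p in Metric.ball p₀ R, x.S 1 p ∂x.vol ≤ x.oneVolume.toReal := by
        rw [integral_eq_lintegral_of_nonneg_ae (Eventually.of_forall fun p => (hS₁ p).le)
          (hint p₀ R).1]
        exact ENNReal.toReal_mono hvol (setLIntegral_le_lintegral _ _)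
      have h4 : 1 / R ^ 2 ≤ 1 := by
        rw [div_le_one (by positivity)]; exact one_le_pow₀ hR
      have h5 : 0 ≤ ∫ p in Metric.ball p₀ R, x.S 1 p ∂x.vol := integral_nonneg fun p => (hS₁ p).le
      exact (mul_le_of_le_one_left h5 h4).trans h3
    obtain ⟨R, hR1, hR2⟩ := (((tendsto_atTop.1 (hlim p₀)) (x.oneVolume.toReal + 1)).and
      (eventually_ge_atTop 1)).exists
    linarith [hb R hR2]
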